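/- Let $M_R,M_T\ge 1$ be integers, $\sigma^2\ge 0$, and let $\Phi$ be an $M_R\times M_T$ real random matrix with i.i.d. phase-noise entries, i.e. $\operatorname{vec}(\Phi)\sim\mathcal N(0,\sigma^2 I_{M_TM_R})$. Let $\tilde\Theta=\mathbf 1+\mathrm j\Phi$, where $\mathbf 1$ is the $M_R\times M_T$ all-ones matrix and $\mathrm j=\sqrt{-1}$ (for a separable timing matrix and small phase noise this is the matrix replacing the phase-error matrix $\Theta=\exp^{\circ}(\mathrm j\Phi)$, with entrywise exponential). Write $\chi^2_{n,s}$ for a random variable distributed as $\|x\|^2$ with $x\sim\mathcal N(0,sI_n)$ in $\mathbb R^n$ (so $\chi^2_{0,s}=0$). Then $$\det(\tilde\Theta\tilde\Theta^H)\stackrel{d}{=}\bigl(\chi^2_{M_T,\sigma^2}+M_TM_R\bigr)\prod_{i=2}^{M_R}\bigl(\chi^2_{M_T-i,\sigma^2}+Z(\eta^{(i)})\bigr)\quad\text{if } M_R\le M_T,$$ $$\det(\tilde\Theta^H\tilde\Theta)\stackrel{d}{=}\bigl(\chi^2_{M_R,\sigma^2}+M_TM_R\bigr)\prod_{i=2}^{M_T}\bigl(\chi^2_{M_R-i,\sigma^2}+Z(\eta^{(i)})\bigr)\quad\text{if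 } M_R>M_T.$$ Empty products are $1$. Here $Z(\eta^{(i)})=\sigma^2\bigl(\eta^{(i)}X^{(i)}_1+(1-\eta^{(i)})X^{(i)}_2\bigr)$ with $X^{(i)}_1,X^{(i)}_2\sim\chi^2_{1,1}$; the $\chi^2$ variables displayed on the right-hand side and all the $X^{(i)}_1,X^{(i)}_2$ are mutually independent; and the $\eta^{(i)}$ are suitable random variables that have a probability density supported in $[0,1]$. They are such that, for every $i$, the triple formed by the $i$-th $\chi^2$ variable, $X^{(i)}_1$ and $X^{(i)}_2$ is independent of the collection consisting of $\eta^{(2)},\dots,\eta^{(i)}$, the $\chi^2$ variable of the first factor, and the $\chi^2$ variables and $X^{(j)}_1,X^{(j)}_2$ of all factors with index $j<i$. -/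

import Mathlib

open MeasureTheory ProbabilityTheory Matrix
open scoped NNReal

noncomputable section

/-- The law of `χ²_{n,v}`: the law of `‖x‖²` for `x ∼ N(0, v Iₙ)` in `ℝⁿ`. -/
def scaledChiSq (n : ℕ) (v : ℝ≥0) : Measure ℝ :=
  (multivariateGaussian (0 : EuclideanSpace ℝ (Fin n))
    ((v : ℝ) • (1 : Matrix (Fin n) (Fin n) ℝ))).map (fun x => ‖x‖ ^ 2)

/-- The matrix `1 + j Φ`, where `1` is the all-ones matrix. -/
def linearizedPhaseMatrix {r t : ℕ} (Φ : Matrix (Fin r) (Fin t) ℝ) : Matrix (Fin r) (Fin t) ℂ :=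
  Matrix.of fun k l => 1 + Complex.I * (Φ k l : ℂ)

/-- `Z(η) = v (η x₁ + (1 - η) x₂)`. -/
def mixedChiSq (v : ℝ≥0) (η x₁ x₂ : ℝ) : ℝ := (v : ℝ) * (η * x₁ + (1 - η) * x₂)

/-- The index set `{2, …, m}`. -/
abbrev FactorIndex (m : ℕ) : Type := {i : ℕ // i ∈ Finset.Icc 2 m}

/-- The random variable `D` is equal in distribution to
`(χ²_{n,v} + m n) ∏_{i=2}^m (χ²_{n-i,v} + Z(η⁽ⁱ⁾))`, for some random variables
`C₁ ∼ χ²_{n,v}`, `C i ∼ χ²_{n-i,v}`, `X₁ i, X₂ i ∼ χ²_{1,1}`, all mutually independent, and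
`[0,1]`-valued random variables `η i` having a probability density, where `η i` may depend on the
factors with smaller index only: for every `i` the triple `(C i, X₁ i, X₂ i)` is
independent of everything that carries a smaller index together with `η i`. -/
def EqInDistChiSqProduct {Ω : Type*} [MeasurableSpace Ω] (m n : ℕ) (v : ℝ≥0)
    (P : Measure Ω) (D : Ω → ℂ) : Prop :=
  ∃ (Ω' : Type) (_ : MeasurableSpace Ω') (Q : Measure Ω')
    (C₁ : Ω' → ℝ) (C X₁ X₂ η : FactorIndex m → Ω' → ℝ),
    IsProbabilityMeasure Q ∧
    HasLaw C₁ (scaledChiSq n v) Q ∧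
    (∀ i, HasLaw (C i) (scaledChiSq (n - (i : ℕ)) v) Q) ∧
    (∀ i, HasLaw (X₁ i) (scaledChiSq 1 1) Q) ∧
    (∀ i, HasLaw (X₂ i) (scaledChiSq 1 1) Q) ∧
    iIndepFun (Sum.elim (fun _ : Unit => C₁) (Sum.elim C (Sum.elim X₁ X₂))) Q ∧
    (∀ i, HasPDF (η i) Q volume) ∧
    (∀ i ω, η i ω ∈ Set.Icc (0 : ℝ) 1) ∧
    (∀ i, IndepFun
      (fun ω => (C i ω, X₁ i ω, X₂ i ω))
      (fun ω => (C₁ ω,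
        (fun j : {j : FactorIndex m // j < i} => (C j ω, X₁ j ω, X₂ j ω)),
        (fun j : {j : FactorIndex m // j ≤ i} => η j ω))) Q) ∧
    IdentDistrib D
      (fun ω => (((C₁ ω + (m : ℝ) * (n : ℝ)) *
        ∏ i : FactorIndex m, (C i ω + mixedChiSq v (η i ω) (X₁ i ω) (X₂ i ω)) : ℝ) : ℂ)) P Q

end

/-! Orthogonal changes of basis on both sides preserve the Gaussian law of Φ and the determinant,
and can turn the all-ones matrix into √(M_R M_T) times one matrix unit. After a factor j is pulled
out of every row, what remains is the Gram determinant of k = M_R - 1 real Gaussian rows and one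
complex row with orthogonal components u = √(M_R M_T) e₀ and w Gaussian, up to phase and conjugation
(`exists_orthogonal_det_linearizedPhaseMatrix`). Its squared norm |u|² + |w|² is the first factor.

The Gaussian rows are then removed one at a time (`map_complexGramDet`). A change of phase and a
rotation bring the complex row to α e₀ + j β e₁ with β² ≤ α² (`exists_canonical_pair`). Removing a
Gaussian row y projects everything to the complement of y, and the squared norm of the complex row,
times |y|², becomes (α² + β²)(c + η y₀² + (1 - η) y₁²), where η = β²/(α² + β²) and c is the sum of
the other squared coordinates of y. This is the next factor. The Gram determinant of the projected
pair gives the next weight as a function of η, c, y₀², y₁² alone (`nextWeight_eq_mixing_div`), so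
the weights form a chain driven by independent triples, and each weight depends on earlier factors
only.

For v > 0 every weight has a density because, with the other variables fixed, it is a function of
one χ² variable that pulls null sets back to null sets. For v = 0 the weights drop out of the
product, so uniform ones serve. The case M_R > M_T follows by transposition. -/

noncomputable section

/-! ### Gram determinants with one distinguished row -/

/-- The determinant of the matrix of dot products of the rows `g, a` with the rows `g, b`. -/
def mixedGramDet {R : Type*} [CommRing R] {k n : ℕ} (g : Fin k → Fin n → R) (a b : Fin n → R) : R :=
  (Matrix.of fun i j => (Fin.snoc g a : Fin (k + 1) → Fin n → R) i ⬝ᵥ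
    (Fin.snoc g b : Fin (k + 1) → Fin n → R) j).det

section Algebra

variable {R : Type*} [CommRing R] {k n : ℕ}

lemma mixedGramDet_comm (g : Fin k → Fin n → R) (a b : Fin n → R) :
    mixedGramDet g a b = mixedGramDet g b a := by
  unfold mixedGramDet
  rw [← det_transpose]
  congr 1
  ext i j
  simp [dotProduct_comm]

lemma mixedGramDet_eq_updateRow (g : Fin k → Fin n → R) (a b : Fin n → R) :
    mixedGramDet g a b = ((Matrix.of fun i j => (Fin.snoc g 0 : Fin (k + 1) → Fin n → R) i ⬝ᵥ
      (Fin.snoc g b : Fin (k + 1) → Fin n → R) j).updateRow (Fin.last k)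
        (fun j => a ⬝ᵥ (Fin.snoc g b : Fin (k + 1) → Fin n → R) j)).det := by
  unfold mixedGramDet
  congr 1
  ext i j
  refine Fin.lastCases ?_ (fun i => ?_) i
  · simp
  · simp [Matrix.updateRow_ne]

lemma mixedGramDet_add_left (g : Fin k → Fin n → R) (a a' b : Fin n → R) :
    mixedGramDet g (a + a') b = mixedGramDet g a b + mixedGramDet g a' b := by
  simp only [mixedGramDet_eq_updateRow g _ b, ← det_updateRow_add, add_dotProduct]
  rfl

lemma mixedGramDet_smul_left (g : Fin k → Fin n → R) (c : R) (a b : Fin n → R) :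
    mixedGramDet g (c • a) b = c * mixedGramDet g a b := by
  simp only [mixedGramDet_eq_updateRow g _ b, ← det_updateRow_smul, smul_dotProduct]
  rfl

lemma mixedGramDet_add_right (g : Fin k → Fin n → R) (a b b' : Fin n → R) :
    mixedGramDet g a (b + b') = mixedGramDet g a b + mixedGramDet g a b' := by
  simp only [mixedGramDet_comm g a, mixedGramDet_add_left]

lemma mixedGramDet_smul_right (g : Fin k → Fin n → R) (c : R) (a b : Fin n → R) :
    mixedGramDet g a (c • b) = c * mixedGramDet g a b := by
  simp only [mixedGramDet_comm g a, mixedGramDet_smul_left]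

lemma mixedGramDet_map {S : Type*} [CommRing S] (f : R →+* S) (g : Fin k → Fin n → R)
    (a b : Fin n → R) :
    mixedGramDet (fun i j => f (g i j)) (fun j => f (a j)) (fun j => f (b j)) =
      f (mixedGramDet g a b) := by
  unfold mixedGramDet
  rw [RingHom.map_det]
  congr 1
  ext i j
  refine Fin.lastCases ?_ (fun i => ?_) i <;> refine Fin.lastCases ?_ (fun j => ?_) j <;>
    simp [dotProduct, map_sum]

lemma mixedGramDet_mulVec (O : Matrix (Fin n) (Fin n) R) (hO : Oᵀ * O = 1)
    (g : Fin k → Fin n → R) (a b : Fin n → R) :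
    mixedGramDet (fun i => O *ᵥ g i) (O *ᵥ a) (O *ᵥ b) = mixedGramDet g a b := by
  have key : ∀ x y : Fin n → R, (O *ᵥ x) ⬝ᵥ (O *ᵥ y) = x ⬝ᵥ y := fun x y => by
    rw [dotProduct_mulVec, ← mulVec_transpose, mulVec_mulVec, hO, one_mulVec]
  unfold mixedGramDet
  congr 1
  ext i j
  refine Fin.lastCases ?_ (fun i => ?_) i <;> refine Fin.lastCases ?_ (fun j => ?_) j <;>
    simp [key]

lemma mixedGramDet_zero (g : Fin 0 → Fin n → R) (a b : Fin n → R) :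
    mixedGramDet g a b = a ⬝ᵥ b := by
  simp [mixedGramDet, Fin.snoc]

end Algebra

/-- Row elimination: subtracting x i 0 / c times the top row clears the first column below c², and
the remaining block contains the dot products without coordinate 0. For c = 0 the top row vanishes.
-/
lemma det_of_dotProduct_cons_single {K : Type*} [Field K] {k n : ℕ} (c : K)
    (x y : Fin k → Fin (n + 1) → K) :
    (Matrix.of fun i j =>
      (Fin.cons (Pi.single 0 c) x : Fin (k + 1) → Fin (n + 1) → K) i ⬝ᵥ
        (Fin.cons (Pi.single 0 c) y : Fin (k + 1) → Fin (n + 1) → K) j).det =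
    c ^ 2 * (Matrix.of fun i j => (fun l : Fin n => x i l.succ) ⬝ᵥ
        (fun l : Fin n => y j l.succ)).det := by
  rcases eq_or_ne c 0 with rfl | hc
  · rw [zero_pow two_ne_zero, zero_mul]
    apply det_eq_zero_of_row_eq_zero 0
    simp
  set N : Matrix (Fin (k + 1)) (Fin (k + 1)) K := Matrix.of fun i j =>
    (Fin.cons (Fin.cons (c ^ 2) fun j => c * y j 0)
      (fun i => Fin.cons 0 fun j => (fun l : Fin n => x i l.succ) ⬝ᵥ
        (fun l : Fin n => y j l.succ)) : Fin (k + 1) → Fin (k + 1) → K) i j with hN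
  rw [det_eq_of_forall_row_eq_smul_add_const (B := N)
    (Fin.cons 0 fun i => x i 0 / c) 0 rfl]
  · rw [det_succ_column_zero, Fin.sum_univ_succ]
    have h : ∀ i : Fin k, N i.succ 0 = 0 := fun i => by simp [hN]
    have h2 : N.submatrix (Fin.succAbove 0) Fin.succ = Matrix.of fun i j =>
        (fun l : Fin n => x i l.succ) ⬝ᵥ (fun l : Fin n => y j l.succ) := by
      ext i j
      simp [hN]
    simp only [h, h2]
    simp [hN]
  · intro i j
    refine Fin.cases ?_ (fun i => ?_) i <;> refine Fin.cases ?_ (fun j => ?_) j <;>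
      simp [hN, dotProduct, Fin.sum_univ_succ] <;> field_simp
    ring

lemma mixedGramDet_cons_single {K : Type*} [Field K] {k n : ℕ} (c : K)
    (g : Fin k → Fin (n + 1) → K) (a b : Fin (n + 1) → K) :
    mixedGramDet (Fin.cons (Pi.single 0 c) g : Fin (k + 1) → Fin (n + 1) → K) a b =
      c ^ 2 * mixedGramDet (fun i => Fin.tail (g i)) (Fin.tail a) (Fin.tail b) := by
  unfold mixedGramDet
  have h := det_of_dotProduct_cons_single c (Fin.snoc g a : Fin (k + 1) → Fin (n + 1) → K)
    (Fin.snoc g b : Fin (k + 1) → Fin (n + 1) → K)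
  rw [← Fin.cons_snoc_eq_snoc_cons, ← Fin.cons_snoc_eq_snoc_cons] 
  rw [h]
  congr 2
  ext i j
  refine Fin.lastCases ?_ (fun i => ?_) i <;> refine Fin.lastCases ?_ (fun j => ?_) j <;>
    simp [Fin.tail_def]

/-- The Gram determinant of the rows `g` and `u + i w`, in real terms. -/
def complexGramDet {k n : ℕ} (g : Fin k → Fin n → ℝ) (u w : Fin n → ℝ) : ℝ :=
  mixedGramDet g u u + mixedGramDet g w w

/-- The new pair is the row u + i w multiplied by e^{iθ}, a unit scalar. -/
lemma complexGramDet_rotate {k n : ℕ} (g : Fin k → Fin n → ℝ) (u w : Fin n → ℝ) (θ : ℝ) :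
    complexGramDet g (Real.cos θ • u - Real.sin θ • w) (Real.sin θ • u + Real.cos θ • w) =
      complexGramDet g u w := by
  simp only [complexGramDet, sub_eq_add_neg, ← neg_smul, mixedGramDet_add_left,
    mixedGramDet_add_right, mixedGramDet_smul_left, mixedGramDet_smul_right,
    mixedGramDet_comm g w u]
  linear_combination (mixedGramDet g u u + mixedGramDet g w w) * Real.sin_sq_add_cos_sq θ

/-- By bilinearity in the last rows and symmetry, the two cross terms cancel; this makes the complex
determinant a real sum of two. -/
lemma mixedGramDet_conj {k n : ℕ} (g : Fin k → Fin n → ℝ) (u w : Fin n → ℝ) :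
    mixedGramDet (fun i j => (g i j : ℂ)) (fun j => (w j : ℂ) - Complex.I * u j)
      (fun j => (w j : ℂ) + Complex.I * u j) = (complexGramDet g u w : ℂ) := by
  have h1 : (fun j => (w j : ℂ) - Complex.I * u j) =
      (fun j => Complex.ofRealHom (w j)) + (-Complex.I) • (fun j => Complex.ofRealHom (u j)) := by
    ext j; simp [sub_eq_add_neg]
  have h2 : (fun j => (w j : ℂ) + Complex.I * u j) =
      (fun j => Complex.ofRealHom (w j)) + Complex.I • (fun j => Complex.ofRealHom (u j)) := by
    ext j; simp
  have h3 : (fun i j => (g i j : ℂ)) = fun i j => Complex.ofRealHom (g i j) := rfl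
  rw [h1, h2, h3]
  simp only [mixedGramDet_add_left, mixedGramDet_add_right, mixedGramDet_smul_left,
    mixedGramDet_smul_right, mixedGramDet_map, mixedGramDet_comm g w u, complexGramDet]
  simp only [Complex.ofRealHom_eq_coe, Complex.ofReal_add]
  linear_combination (-((mixedGramDet g u u : ℝ) : ℂ)) * Complex.I_sq

/-! ### Orthogonal normal forms -/

/-- Normalise the nonzero vectors, complete them to an orthonormal basis and use it as the rows of
O. Zero vectors are allowed, so a shorter orthogonal family can be padded with zeros. -/
lemma exists_orthogonal_mulVec_eq_single {n : ℕ} (x : Fin n → Fin n → ℝ)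
    (hx : Pairwise fun i j => x i ⬝ᵥ x j = 0) :
    ∃ O : Matrix (Fin n) (Fin n) ℝ, Oᵀ * O = 1 ∧
      ∀ j, O *ᵥ x j = Pi.single j (Real.sqrt (x j ⬝ᵥ x j)) := by
  have hd : ∀ a b : Fin n → ℝ, inner ℝ (WithLp.toLp 2 a) (WithLp.toLp 2 b) = a ⬝ᵥ b := by
    intro a b
    simp [PiLp.inner_apply, dotProduct, mul_comm]
  have hn : ∀ a : Fin n → ℝ, ‖WithLp.toLp 2 a‖ = Real.sqrt (a ⬝ᵥ a) := by
    intro a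
    rw [← hd, real_inner_self_eq_norm_sq, Real.sqrt_sq (norm_nonneg _)]
  let e : Fin n → EuclideanSpace ℝ (Fin n) := fun j =>
    (‖WithLp.toLp 2 (x j)‖)⁻¹ • WithLp.toLp 2 (x j)
  have he : Orthonormal ℝ (fun j : {j | x j ≠ 0} => e j) := by
    constructor
    · rintro ⟨j, hj⟩
      simp only [e, norm_smul, norm_inv, norm_norm]
      apply inv_mul_cancel₀
      simpa using hj
    · rintro ⟨i, hi⟩ ⟨j, hj⟩ hij
      have : i ≠ j := fun h => hij (Subtype.ext h)
      simp [e, hd, hx this]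
  obtain ⟨b, hb⟩ := Orthonormal.exists_orthonormalBasis_extension_of_card_eq
    (𝕜 := ℝ) (v := e) (s := {j | x j ≠ 0}) (by simp) he
  have hb' : ∀ j, WithLp.toLp 2 (x j) = Real.sqrt (x j ⬝ᵥ x j) • b j := by
    intro j
    by_cases hj : x j = 0
    · simp [hj]
    · rw [hb j hj, ← hn, smul_smul, mul_inv_cancel₀, one_smul]
      simpa using hj
  refine ⟨Matrix.of fun i l => b i l, ?_, ?_⟩
  · rw [mul_eq_one_comm]
    ext i j
    have := b.inner_eq_ite i j
    rw [one_apply, ← this, mul_apply, PiLp.inner_apply]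
    simp [mul_comm]
  · intro j
    ext i
    have h1 : (Matrix.of (fun i l => b i l) *ᵥ x j) i = inner ℝ (b i) (WithLp.toLp 2 (x j)) := by
      simp [mulVec, PiLp.inner_apply, dotProduct, mul_comm]
    rw [h1, hb' j, inner_smul_right, b.inner_eq_ite]
    by_cases h : i = j
    · subst h; simp
    · simp [h]


lemma exists_orthogonal_det_linearizedPhaseMatrix (k n : ℕ) :
    ∃ (U : Matrix (Fin (k + 1)) (Fin (k + 1)) ℝ) (O : Matrix (Fin (n + 1)) (Fin (n + 1)) ℝ),
      Uᵀ * U = 1 ∧ Oᵀ * O = 1 ∧ ∀ X : Matrix (Fin (k + 1)) (Fin (n + 1)) ℝ,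
        (linearizedPhaseMatrix X * (linearizedPhaseMatrix X)ᴴ).det =
          (complexGramDet (fun i => (U * X * Oᵀ) i.castSucc)
            (Pi.single 0 (Real.sqrt ((k + 1) * (n + 1)))) ((U * X * Oᵀ) (Fin.last k)) : ℂ) := by
  -- The family is the all-ones vector at the last index, padded with zero vectors, so U sends it to
  -- a multiple of the last basis vector; O below sends it to a multiple of the first.
  obtain ⟨U, hU, hU1⟩ := exists_orthogonal_mulVec_eq_single
    (Pi.single (Fin.last k) 1 : Fin (k + 1) → Fin (k + 1) → ℝ) (by
      intro i j hij
      by_cases h : i = Fin.last k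
      · have : j ≠ Fin.last k := fun h' => hij (h.trans h'.symm)
        simp [this]
      · simp [h])
  obtain ⟨O, hO, hO1⟩ := exists_orthogonal_mulVec_eq_single
    (Pi.single 0 1 : Fin (n + 1) → Fin (n + 1) → ℝ) (by
      intro i j hij
      by_cases h : i = 0
      · have : j ≠ 0 := fun h' => hij (h.trans h'.symm)
        simp [this]
      · simp [h])
  replace hU1 := hU1 (Fin.last k)
  replace hO1 := hO1 0
  simp only [Pi.single_eq_same] at hU1 hO1
  have e1 : ((1 : Fin (k + 1) → ℝ) ⬝ᵥ 1) = k + 1 := by simp [dotProduct]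
  have e2 : ((1 : Fin (n + 1) → ℝ) ⬝ᵥ 1) = n + 1 := by simp [dotProduct]
  rw [e1] at hU1
  rw [e2] at hO1
  refine ⟨U, O, hU, hO, fun X => ?_⟩
  set Y := U * X * Oᵀ with hY
  set A := linearizedPhaseMatrix X with hA
  have hAX : A = (Matrix.vecMulVec 1 1 : Matrix (Fin (k + 1)) (Fin (n + 1)) ℝ).map
      Complex.ofRealHom + Complex.I • X.map Complex.ofRealHom := by
    ext i j
    simp [hA, linearizedPhaseMatrix]
  set Uc := U.map Complex.ofRealHom with hUc
  set Oc := O.map Complex.ofRealHom with hOc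
  have hUU : Uᵀ.map Complex.ofRealHom * Uc = 1 := by
    rw [hUc, ← Matrix.map_mul, hU, Matrix.map_one _ (map_zero _) (map_one _)]
  have hOO : Oᵀ.map Complex.ofRealHom * Oc = 1 := by
    rw [hOc, ← Matrix.map_mul, hO, Matrix.map_one _ (map_zero _) (map_one _)]
  have hUH : Ucᴴ = Uᵀ.map Complex.ofRealHom := by
    ext i j
    simp [hUc]
  set A' := Uc * A * Oᵀ.map Complex.ofRealHom with hA'
  have hOH : (Oᵀ.map Complex.ofRealHom)ᴴ = Oc := by
    ext i j
    simp [hOc]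
  have hdet : (A * Aᴴ).det = (A' * A'ᴴ).det := by
    have h1 : A' * A'ᴴ = Uc * (A * Aᴴ) * Uᵀ.map Complex.ofRealHom := by
      rw [hA', conjTranspose_mul, conjTranspose_mul, hUH, hOH]
      calc _ = Uc * A * (Oᵀ.map Complex.ofRealHom * Oc) * Aᴴ * Uᵀ.map Complex.ofRealHom := by
            simp only [Matrix.mul_assoc]
        _ = _ := by rw [hOO]; simp only [Matrix.mul_assoc, Matrix.mul_one]
    have h2 : Uc.det * (Uᵀ.map Complex.ofRealHom).det = 1 := by
      rw [mul_comm, ← det_mul, hUU, det_one]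
    rw [h1, det_mul, det_mul]
    linear_combination -(A * Aᴴ).det * h2
  have hA'2 : A' = (Matrix.vecMulVec (U *ᵥ 1) (O *ᵥ 1)).map Complex.ofRealHom
      + Complex.I • Y.map Complex.ofRealHom := by
    rw [hA', hAX, Matrix.mul_add, Matrix.add_mul, Matrix.mul_smul, Matrix.smul_mul, hUc,
      ← Matrix.map_mul, ← Matrix.map_mul, ← Matrix.map_mul, ← Matrix.map_mul, mul_vecMulVec,
      vecMulVec_mul, ← mulVec_transpose, transpose_transpose]
  have hsq : Real.sqrt ((k + 1) * (n + 1)) = Real.sqrt (k + 1) * Real.sqrt (n + 1) :=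
    Real.sqrt_mul (by positivity) _
  -- Every row carries a factor i, which meets its conjugate -i in the Gram matrix; only the last
  -- row keeps a nonreal part, from the image of the all-ones matrix.
  have key : ∀ i l, A' i l = Complex.I * (Fin.snoc (fun i j => (Y i.castSucc j : ℂ))
      (fun j => (Y (Fin.last k) j : ℂ) - Complex.I * ((Pi.single 0
        (Real.sqrt ((k + 1) * (n + 1))) : Fin (n + 1) → ℝ) j : ℂ)) :
        Fin (k + 1) → Fin (n + 1) → ℂ) i l := by
    intro i l
    rw [hA'2, hU1, hO1, hsq]
    refine Fin.lastCases ?_ (fun i => ?_) i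
    · by_cases hl : l = 0
      · subst hl
        simp [vecMulVec_apply]
        linear_combination ((Real.sqrt (k + 1) : ℂ) * Real.sqrt (n + 1)) * Complex.I_sq
      · simp [vecMulVec_apply, hl]
    · simp [vecMulVec_apply]
  have key2 : ∀ i l, star (A' i l) = -Complex.I * (Fin.snoc (fun i j => (Y i.castSucc j : ℂ))
      (fun j => (Y (Fin.last k) j : ℂ) + Complex.I * ((Pi.single 0
        (Real.sqrt ((k + 1) * (n + 1))) : Fin (n + 1) → ℝ) j : ℂ)) :
        Fin (k + 1) → Fin (n + 1) → ℂ) i l := by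
    intro i l
    rw [key]
    refine Fin.lastCases ?_ (fun i => ?_) i <;> simp
  rw [hdet, ← mixedGramDet_conj, mixedGramDet]
  congr 1
  ext i j
  rw [mul_apply]
  simp only [conjTranspose_apply, of_apply, dotProduct]
  refine Finset.sum_congr rfl fun l _ => ?_
  rw [key2, key]
  generalize (Fin.snoc _ _ : Fin (k + 1) → Fin (n + 1) → ℂ) i l = a
  generalize (Fin.snoc _ _ : Fin (k + 1) → Fin (n + 1) → ℂ) j l = b
  linear_combination (-(a * b)) * Complex.I_sq

/-! ### Gaussian vectors and matrices, and their orthogonal invariance -/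

/-- The law of independent centered Gaussian variables of variance `v`. -/
abbrev isoGaussian (ι : Type*) [Fintype ι] (v : ℝ≥0) : Measure (ι → ℝ) :=
  Measure.pi fun _ : ι => gaussianReal 0 v

lemma map_toLp_isoGaussian (ι : Type*) [Fintype ι] [DecidableEq ι] (v : ℝ≥0) :
    (isoGaussian ι v).map (WithLp.toLp 2) =
      multivariateGaussian (0 : EuclideanSpace ℝ ι) ((v : ℝ) • (1 : Matrix ι ι ℝ)) := by
  apply Measure.ext_of_charFun (E := EuclideanSpace ℝ ι)
  ext t
  have hS : ((v : ℝ) • (1 : Matrix ι ι ℝ)).PosSemidef := PosSemidef.one.smul v.2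
  rw [charFun_multivariateGaussian hS]
  simp_rw [charFun_pi, charFun_gaussianReal, ← Complex.exp_sum]
  congr 1
  simp [dotProduct, Finset.sum_div, smul_mulVec, pow_two]
  exact Finset.sum_congr rfl fun i _ => by ring

lemma measurePreserving_sqrt_mul_gaussianReal (v : ℝ≥0) :
    MeasurePreserving (fun x => Real.sqrt v * x) (gaussianReal 0 1) (gaussianReal 0 v) := by
  refine ⟨by fun_prop, ?_⟩
  rw [gaussianReal_map_const_mul]
  congr 1
  · simp
  · ext; simp

lemma isoGaussian_eq_map_stdGaussian (ι : Type*) [Fintype ι] (v : ℝ≥0) :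
    isoGaussian ι v = (stdGaussian (EuclideanSpace ℝ ι)).map
      (fun x => Real.sqrt v • WithLp.ofLp x) := by
  rw [← map_pi_eq_stdGaussian, Measure.map_map (by fun_prop) (by fun_prop)]
  have := Measure.pi_map_pi (μ := fun _ : ι => gaussianReal 0 1)
    (f := fun _ x => Real.sqrt v * x) (fun i => by fun_prop)
  simp only [(measurePreserving_sqrt_mul_gaussianReal v).map_eq] at this
  exact this.symm

lemma measurePreserving_mulVec_isoGaussian {ι : Type*} [Fintype ι] [DecidableEq ι] (v : ℝ≥0)
    (O : Matrix ι ι ℝ) (hO : Oᵀ * O = 1) :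
    MeasurePreserving (fun x => O *ᵥ x) (isoGaussian ι v) (isoGaussian ι v) := by
  have hm : Measurable (fun x : ι → ℝ => O *ᵥ x) := by
    have : Continuous (fun x : ι → ℝ => O *ᵥ x) := by fun_prop
    exact this.measurable
  refine ⟨hm, ?_⟩
  let L : EuclideanSpace ℝ ι ≃ₗᵢ[ℝ] EuclideanSpace ℝ ι :=
    LinearIsometryEquiv.ofSurjective
      { toLinearMap := Matrix.toEuclideanLin O
        norm_map' := by
          intro x
          rw [← sq_eq_sq₀ (norm_nonneg _) (norm_nonneg _), EuclideanSpace.real_norm_sq_eq,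
            EuclideanSpace.real_norm_sq_eq]
          have key : ∀ x : ι → ℝ, (O *ᵥ x) ⬝ᵥ (O *ᵥ x) = x ⬝ᵥ x := fun x => by
            rw [dotProduct_mulVec, ← mulVec_transpose, mulVec_mulVec, hO, one_mulVec]
          simpa [dotProduct, pow_two] using key x.ofLp }
      (fun y => ⟨WithLp.toLp 2 (Oᵀ *ᵥ y.ofLp), by
        have : O * Oᵀ = 1 := mul_eq_one_comm.mp hO
        ext i
        simp [mulVec_mulVec, this]⟩)
  rw [isoGaussian_eq_map_stdGaussian, Measure.map_map hm (by fun_prop)]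
  conv_rhs => rw [← stdGaussian_map L, Measure.map_map (by fun_prop) (by fun_prop)]
  congr 1
  ext x i
  simp only [Function.comp_apply, mulVec_smul]
  rfl

lemma scaledChiSq_eq_map (n : ℕ) (v : ℝ≥0) :
    scaledChiSq n v = (isoGaussian (Fin n) v).map (fun x => x ⬝ᵥ x) := by
  rw [scaledChiSq, ← map_toLp_isoGaussian, Measure.map_map (by fun_prop) (by fun_prop)]
  congr 1
  ext x
  simp [EuclideanSpace.real_norm_sq_eq, dotProduct, ← pow_two]

lemma measurePreserving_finCons {α : Type*} [MeasurableSpace α] {n : ℕ}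
    (μ : Fin (n + 1) → Measure α) [∀ i, SigmaFinite (μ i)] :
    MeasurePreserving (fun p : α × (Fin n → α) => (Fin.cons p.1 p.2 : Fin (n + 1) → α))
      ((μ 0).prod (Measure.pi fun i => μ i.succ)) (Measure.pi μ) := by
  have h := (measurePreserving_piFinSuccAbove (α := fun _ => α) μ 0).symm
  convert h using 1
  · ext p i
    refine Fin.cases ?_ (fun i => ?_) i <;> simp [MeasurableEquiv.piFinSuccAbove]
  · simp

lemma measurePreserving_finSnoc {α : Type*} [MeasurableSpace α] {n : ℕ}
    (μ : Fin (n + 1) → Measure α) [∀ i, SigmaFinite (μ i)] :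
    MeasurePreserving (fun p : α × (Fin n → α) => (Fin.snoc p.2 p.1 : Fin (n + 1) → α))
      ((μ (Fin.last n)).prod (Measure.pi fun i => μ i.castSucc)) (Measure.pi μ) := by
  have h := (measurePreserving_piFinSuccAbove (α := fun _ => α) μ (Fin.last n)).symm
  convert h using 1
  · ext p i
    refine Fin.lastCases ?_ (fun i => ?_) i <;> simp [MeasurableEquiv.piFinSuccAbove]
  · simp

lemma map_pi_pi_comp_equiv {α β γ E : Type*} [Fintype α] [Fintype β] [Fintype γ]
    [MeasurableSpace E] (μ : Measure E) [SigmaFinite μ] (e : γ ≃ α × β) :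
    (Measure.pi fun _ : α => Measure.pi fun _ : β => μ).map (fun x c => x (e c).1 (e c).2) =
      Measure.pi fun _ : γ => μ := by
  symm
  apply Measure.pi_eq
  intro s hs
  rw [Measure.map_apply (by fun_prop) (MeasurableSet.univ_pi hs)]
  have : (fun (x : α → β → E) c => x (e c).1 (e c).2) ⁻¹' Set.univ.pi s =
      Set.univ.pi fun a => Set.univ.pi fun b => s (e.symm (a, b)) := by
    ext x
    simp only [Set.mem_preimage, Set.mem_univ_pi]
    constructor
    · intro h a b
      simpa using h (e.symm (a, b))
    · intro h c
      have := h (e c).1 (e c).2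
      rwa [Prod.mk.eta, e.symm_apply_apply] at this
  rw [this, Measure.pi_pi]
  simp only [Measure.pi_pi]
  rw [← Fintype.prod_prod_type' (f := fun a b => μ (s (e.symm (a, b)))),
    ← e.symm.prod_comp]

lemma measurePreserving_pi_swap {α β E : Type*} [Fintype α] [Fintype β]
    [MeasurableSpace E] (μ : Measure E) [SigmaFinite μ] :
    MeasurePreserving (fun (x : α → β → E) b a => x a b)
      (Measure.pi fun _ : α => Measure.pi fun _ : β => μ)
      (Measure.pi fun _ : β => Measure.pi fun _ : α => μ) := by
  refine ⟨by fun_prop, ?_⟩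
  have h1 := map_pi_pi_comp_equiv μ (Equiv.prodComm β α)
  have h2 := map_pi_pi_comp_equiv μ (Equiv.refl (β × α))
  have h3 : (Measure.pi fun _ : β × α => μ).map (fun x b a => x (b, a)) =
      Measure.pi fun _ : β => Measure.pi fun _ : α => μ := by
    rw [← h2, Measure.map_map (by fun_prop) (by fun_prop)]
    exact Measure.map_id
  rw [← h3, ← h1, Measure.map_map (by fun_prop) (by fun_prop)]
  rfl

lemma hasLaw_rows_of_vec {Ω : Type*} [MeasurableSpace Ω] {P : Measure Ω} {m n : ℕ} {v : ℝ≥0}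
    {Φ : Ω → Matrix (Fin m) (Fin n) ℝ}
    (hΦ : HasLaw (fun ω => WithLp.toLp 2 (Matrix.vec (Φ ω)))
      (multivariateGaussian (0 : EuclideanSpace ℝ (Fin n × Fin m))
        ((v : ℝ) • (1 : Matrix (Fin n × Fin m) (Fin n × Fin m) ℝ))) P) :
    HasLaw (fun ω i j => Φ ω i j) (Measure.pi fun _ : Fin m => isoGaussian (Fin n) v) P := by
  have h1 := map_pi_pi_comp_equiv (gaussianReal 0 v) (Equiv.prodComm (Fin n) (Fin m))
  have hg : Measurable (fun (z : EuclideanSpace ℝ (Fin n × Fin m)) (i : Fin m) (j : Fin n) =>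
      z (j, i)) := by fun_prop
  refine ⟨hg.comp_aemeasurable hΦ.aemeasurable, ?_⟩
  have h2 : (fun ω i j => Φ ω i j) = (fun (z : EuclideanSpace ℝ (Fin n × Fin m)) (i : Fin m)
      (j : Fin n) => z (j, i)) ∘ (fun ω => WithLp.toLp 2 (Matrix.vec (Φ ω))) := rfl
  rw [h2, ← AEMeasurable.map_map_of_aemeasurable hg.aemeasurable hΦ.aemeasurable, hΦ.map_eq,
    ← map_toLp_isoGaussian, Measure.map_map hg (by fun_prop), isoGaussian, ← h1,
    Measure.map_map (by fun_prop) (by fun_prop)]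
  exact Measure.map_id

/-- O acts on each row and U on each column; independence of all entries lets a transposition pass
from one description to the other. -/
lemma measurePreserving_mul_mul_transpose {m n : ℕ} (v : ℝ≥0) (U : Matrix (Fin m) (Fin m) ℝ)
    (O : Matrix (Fin n) (Fin n) ℝ) (hU : Uᵀ * U = 1) (hO : Oᵀ * O = 1) :
    MeasurePreserving (fun (X : Fin m → Fin n → ℝ) i j => (U * Matrix.of X * Oᵀ) i j)
      (Measure.pi fun _ : Fin m => isoGaussian (Fin n) v)
      (Measure.pi fun _ : Fin m => isoGaussian (Fin n) v) := by
  have h1 := measurePreserving_pi (fun _ : Fin m => isoGaussian (Fin n) v) _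
    (fun _ => measurePreserving_mulVec_isoGaussian v O hO)
  have h2 := measurePreserving_pi (fun _ : Fin n => isoGaussian (Fin m) v) _
    (fun _ => measurePreserving_mulVec_isoGaussian v U hU)
  have s1 := measurePreserving_pi_swap (α := Fin m) (β := Fin n) (gaussianReal 0 v)
  have s2 := measurePreserving_pi_swap (α := Fin n) (β := Fin m) (gaussianReal 0 v)
  have := (s2.comp (h2.comp s1)).comp h1
  convert this using 1
  ext X i j
  rw [Matrix.mul_assoc, mul_apply]
  simp only [Function.comp, mulVec, dotProduct, of_apply, mul_apply, transpose_apply]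
  exact Finset.sum_congr rfl fun l _ => by
    congr 1
    exact Finset.sum_congr rfl fun l' _ => mul_comm _ _

lemma measurePreserving_finTail_isoGaussian (n : ℕ) (v : ℝ≥0) :
    MeasurePreserving (fun x : Fin (n + 1) → ℝ => Fin.tail x)
      (isoGaussian (Fin (n + 1)) v) (isoGaussian (Fin n) v) := by
  have h := measurePreserving_finCons (fun _ : Fin (n + 1) => gaussianReal 0 v)
  have hm : Measurable (fun x : Fin (n + 1) → ℝ => (Fin.tail x : Fin n → ℝ)) := by
    unfold Fin.tail; fun_prop
  refine ⟨hm, ?_⟩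
  rw [isoGaussian, ← h.map_eq, Measure.map_map hm h.measurable]
  exact (measurePreserving_snd (μ := gaussianReal 0 v) (ν := isoGaussian (Fin n) v)).map_eq

lemma measurePreserving_sq_gaussianReal (v : ℝ≥0) :
    MeasurePreserving (fun x => x ^ 2) (gaussianReal 0 v) (scaledChiSq 1 v) := by
  have h := measurePreserving_eval (μ := fun _ : Fin 1 => gaussianReal 0 v) 0
  refine ⟨by fun_prop, ?_⟩
  rw [scaledChiSq_eq_map, ← h.map_eq, Measure.map_map (by fun_prop) h.measurable]
  congr 1
  ext x
  simp [dotProduct, pow_two]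

instance (n : ℕ) (v : ℝ≥0) : IsProbabilityMeasure (scaledChiSq n v) := by
  rw [scaledChiSq_eq_map]
  exact Measure.isProbabilityMeasure_map (by unfold dotProduct; fun_prop)

lemma measurePreserving_dotProduct_self (n : ℕ) (v : ℝ≥0) :
    MeasurePreserving (fun x => x ⬝ᵥ x) (isoGaussian (Fin n) v) (scaledChiSq n v) :=
  ⟨by unfold dotProduct; fun_prop, (scaledChiSq_eq_map n v).symm⟩

/-! ### The chain of mixing weights -/

/-- The smaller root in `[0, 1 / 2]` of `η (1 - η) = q`, for `0 ≤ q ≤ 1 / 4`. -/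
def mixing (q : ℝ) : ℝ := (1 - Real.sqrt (1 - 4 * |q|)) / 2

/-- The factor `c + v (η x₁ + (1 - η) x₂)`. -/
def chainFactor (v : ℝ≥0) (η : ℝ) (x : ℝ × ℝ × ℝ) : ℝ := x.1 + mixedChiSq v η x.2.1 x.2.2

/-- The mixing weight of the factor that follows a factor with weight `η` and variables `x`. -/
def nextWeight (v : ℝ≥0) (η : ℝ) (x : ℝ × ℝ × ℝ) : ℝ :=
  mixing (η * (1 - η) * x.1 * (x.1 + v * (x.2.1 + x.2.2)) / chainFactor v η x ^ 2)

/-- The mixing weights of all factors. -/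
def weightSeq (v : ℝ≥0) (η : ℝ) (x : ℕ → ℝ × ℝ × ℝ) : ℕ → ℝ
  | 0 => η
  | j + 1 => nextWeight v (weightSeq v η x j) (x j)

/-- The product of the first `k` factors. -/
def chainProd (k : ℕ) (v : ℝ≥0) (η : ℝ) (x : ℕ → ℝ × ℝ × ℝ) : ℝ :=
  ∏ j ∈ Finset.range k, chainFactor v (weightSeq v η x j) (x j)

/-- Extension of a finite sequence by zero. -/
def extendZero {α : Type*} [Zero α] {k : ℕ} (x : Fin k → α) (j : ℕ) : α :=
  if h : j < k then x ⟨j, h⟩ else 0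

/-- The law of `(c, x₁, x₂)` in a factor. -/
abbrev factorLaw (n : ℕ) (v : ℝ≥0) : Measure (ℝ × ℝ × ℝ) :=
  (scaledChiSq n v).prod ((scaledChiSq 1 1).prod (scaledChiSq 1 1))

/-- The mixing weight for the complex row `u + i w`. -/
def pairWeight {n : ℕ} (u w : Fin n → ℝ) : ℝ :=
  mixing (((u ⬝ᵥ u) * (w ⬝ᵥ w) - (u ⬝ᵥ w) ^ 2) / (u ⬝ᵥ u + w ⬝ᵥ w) ^ 2)

/-- `weightSeq` recurses at the end, whereas the induction over Gaussian rows peels off the first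
triple. -/
lemma weightSeq_succ' (v : ℝ≥0) (η : ℝ) (x : ℕ → ℝ × ℝ × ℝ) (j : ℕ) :
    weightSeq v η x (j + 1) = weightSeq v (nextWeight v η (x 0)) (fun i => x (i + 1)) j := by
  induction j with
  | zero => rfl
  | succ j ih => rw [weightSeq, ih, weightSeq]

lemma chainProd_succ (k : ℕ) (v : ℝ≥0) (η : ℝ) (x : ℕ → ℝ × ℝ × ℝ) :
    chainProd (k + 1) v η x =
      chainFactor v η (x 0) * chainProd k v (nextWeight v η (x 0)) (fun i => x (i + 1)) := by
  rw [chainProd, Finset.prod_range_succ', mul_comm]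
  simp only [weightSeq_succ']
  rfl

lemma extendZero_cons_zero {α : Type*} [Zero α] {k : ℕ} (a : α) (x : Fin k → α) :
    extendZero (Fin.cons a x : Fin (k + 1) → α) 0 = a := by
  simp [extendZero]

lemma extendZero_cons_succ {α : Type*} [Zero α] {k : ℕ} (a : α) (x : Fin k → α) :
    (fun j => extendZero (Fin.cons a x : Fin (k + 1) → α) (j + 1)) = extendZero x := by
  ext j
  by_cases h : j < k
  · have : (⟨j + 1, by omega⟩ : Fin (k + 1)) = Fin.succ ⟨j, h⟩ := rfl
    simp only [extendZero, h, dite_true, this, Fin.cons_succ, add_lt_add_iff_right]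
  · simp [extendZero, h]

@[fun_prop]
lemma measurable_mixing : Measurable mixing := by
  unfold mixing
  have : Continuous (fun q : ℝ => (1 - Real.sqrt (1 - 4 * |q|)) / 2) := by fun_prop
  exact this.measurable

/-- The absolute value keeps the radicand at most 1, and the square root of a negative number is 0,
so no restriction on q is needed. -/
lemma mixing_mem_Icc (q : ℝ) : mixing q ∈ Set.Icc (0 : ℝ) 1 := by
  have h1 := Real.sqrt_nonneg (1 - 4 * |q|)
  have h2 : Real.sqrt (1 - 4 * |q|) ≤ 1 := Real.sqrt_le_one.mpr (by linarith [abs_nonneg q])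
  constructor <;> unfold mixing <;> linarith

/-- For η = b / (a + b) the argument is η (1 - η), and b ≤ a selects the smaller root. -/
lemma mixing_div_sq {a b : ℝ} (ha : 0 ≤ b) (hab : b ≤ a) (h : a + b ≠ 0) :
    mixing (a * b / (a + b) ^ 2) = b / (a + b) := by
  have h0 : 0 ≤ a * b / (a + b) ^ 2 := by
    have : 0 ≤ a := ha.trans hab
    positivity
  have h1 : 1 - 4 * (a * b / (a + b) ^ 2) = ((a - b) / (a + b)) ^ 2 := by
    field_simp
    ring
  have h2 : 0 ≤ (a - b) / (a + b) := div_nonneg (by linarith) (by linarith)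
  rw [mixing, abs_of_nonneg h0, h1, Real.sqrt_sq h2]
  field_simp
  ring

section Measurability

variable {α : Type*} [MeasurableSpace α]

@[fun_prop]
lemma measurable_chainFactor (v : ℝ≥0) {η : α → ℝ} {x : α → ℝ × ℝ × ℝ} (hη : Measurable η)
    (hx : Measurable x) : Measurable fun a => chainFactor v (η a) (x a) := by
  unfold chainFactor mixedChiSq
  fun_prop

@[fun_prop]
lemma measurable_nextWeight (v : ℝ≥0) {η : α → ℝ} {x : α → ℝ × ℝ × ℝ} (hη : Measurable η)
    (hx : Measurable x) : Measurable fun a => nextWeight v (η a) (x a) := by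
  unfold nextWeight
  fun_prop

lemma measurable_weightSeq (v : ℝ≥0) {η : α → ℝ} {x : α → ℕ → ℝ × ℝ × ℝ} (hη : Measurable η)
    (hx : Measurable x) (j : ℕ) : Measurable fun a => weightSeq v (η a) (x a) j := by
  induction j with
  | zero => exact hη
  | succ j ih =>
    simp only [weightSeq]
    fun_prop

lemma measurable_chainProd (k : ℕ) (v : ℝ≥0) {η : α → ℝ} {x : α → ℕ → ℝ × ℝ × ℝ}
    (hη : Measurable η) (hx : Measurable x) : Measurable fun a => chainProd k v (η a) (x a) := by
  unfold chainProd
  refine Finset.measurable_prod _ fun j _ => ?_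
  have := measurable_weightSeq v hη hx j
  fun_prop

@[fun_prop]
lemma measurable_extendZero {β : Type*} [Zero β] [MeasurableSpace β] {k : ℕ} :
    Measurable (extendZero : (Fin k → β) → ℕ → β) := by
  refine measurable_pi_lambda _ fun j => ?_
  by_cases h : j < k
  · simp only [extendZero, h, dite_true]
    fun_prop
  · simp only [extendZero, h, dite_false]
    fun_prop

@[fun_prop]
lemma continuous_mixedGramDet {β : Type*} [TopologicalSpace β] {k n : ℕ}
    {g : β → Fin k → Fin n → ℝ} {a b : β → Fin n → ℝ} (hg : Continuous g) (ha : Continuous a)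
    (hb : Continuous b) : Continuous fun t => mixedGramDet (g t) (a t) (b t) := by
  unfold mixedGramDet
  refine Continuous.matrix_det (continuous_matrix fun i j => ?_)
  refine Fin.lastCases ?_ (fun i => ?_) i <;> refine Fin.lastCases ?_ (fun j => ?_) j <;>
    simp only [of_apply, Fin.snoc_last, Fin.snoc_castSucc, dotProduct] <;> fun_prop

@[fun_prop]
lemma continuous_complexGramDet {β : Type*} [TopologicalSpace β] {k n : ℕ}
    {g : β → Fin k → Fin n → ℝ} {a b : β → Fin n → ℝ} (hg : Continuous g) (ha : Continuous a)
    (hb : Continuous b) : Continuous fun t => complexGramDet (g t) (a t) (b t) := by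
  unfold complexGramDet
  fun_prop

end Measurability

/-! ### Removing the Gaussian rows one at a time -/

lemma dotProduct_self_nonneg_of_real {ι : Type*} [Fintype ι] (x : ι → ℝ) : 0 ≤ x ⬝ᵥ x :=
  Finset.sum_nonneg fun i _ => mul_self_nonneg (x i)

/-- With a = u·u, b = w·w, c = u·w, the number z = a - b + 2ic is the bilinear square of u + i w,
which a phase e^{iθ} multiplies by e^{2iθ}. Taking θ = -arg z / 2 makes it real and nonnegative,
that is, the rotated pair is orthogonal with the longer vector first. -/
lemma exists_rotation (a b c : ℝ) : ∃ θ : ℝ,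
    Real.cos θ * Real.sin θ * (a - b) + (Real.cos θ ^ 2 - Real.sin θ ^ 2) * c = 0 ∧
    0 ≤ (Real.cos θ ^ 2 - Real.sin θ ^ 2) * (a - b) - 4 * Real.cos θ * Real.sin θ * c := by
  set z : ℂ := ⟨a - b, 2 * c⟩ with hz
  refine ⟨-(z.arg / 2), ?_⟩
  have h1 : ‖z‖ * Real.cos (z.arg) = a - b := Complex.norm_mul_cos_arg z
  have h2 : ‖z‖ * Real.sin (z.arg) = 2 * c := Complex.norm_mul_sin_arg z
  have h3 := Real.cos_two_mul (z.arg / 2)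
  have h4 := Real.sin_two_mul (z.arg / 2)
  have h5 := Real.sin_sq_add_cos_sq (z.arg / 2)
  have h6 := Real.sin_sq_add_cos_sq z.arg
  rw [mul_div_cancel₀ _ two_ne_zero] at h3 h4
  rw [Real.cos_neg, Real.sin_neg]
  set C := Real.cos (z.arg / 2)
  set S := Real.sin (z.arg / 2)
  have h7 : C ^ 2 - S ^ 2 = Real.cos z.arg := by linarith
  have h8 : C * S = Real.sin z.arg / 2 := by linarith
  constructor
  · rw [neg_sq, h7, mul_neg, h8, ← h1]
    have : c = ‖z‖ * Real.sin z.arg / 2 := by linarith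
    rw [this]; ring
  · rw [neg_sq, h7, mul_neg, mul_assoc 4, h8, ← h1]
    have h9 : c = ‖z‖ * Real.sin z.arg / 2 := by linarith
    have : Real.cos z.arg * (‖z‖ * Real.cos z.arg) - -(4 * (Real.sin z.arg / 2)) * c = ‖z‖ := by
      rw [h9]; linear_combination ‖z‖ * h6
    linarith [norm_nonneg z]

/-- Phase rotation keeps the sum of squared norms and the Gram determinant of the pair, so these
determine α² and β²; the orthogonal pair is then moved onto the first two axes. -/
lemma exists_canonical_pair {n : ℕ} (u w : Fin (n + 2) → ℝ) :
    ∃ (O : Matrix (Fin (n + 2)) (Fin (n + 2)) ℝ) (α β : ℝ), Oᵀ * O = 1 ∧ β ^ 2 ≤ α ^ 2 ∧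
      α ^ 2 + β ^ 2 = u ⬝ᵥ u + w ⬝ᵥ w ∧
      α ^ 2 * β ^ 2 = (u ⬝ᵥ u) * (w ⬝ᵥ w) - (u ⬝ᵥ w) ^ 2 ∧
      ∀ (k : ℕ) (g : Fin k → Fin (n + 2) → ℝ), complexGramDet g u w =
        complexGramDet (fun i => O *ᵥ g i) (Pi.single 0 α) (Pi.single 1 β) := by
  obtain ⟨θ, h1, h2⟩ := exists_rotation (u ⬝ᵥ u) (w ⬝ᵥ w) (u ⬝ᵥ w)
  set u' := Real.cos θ • u - Real.sin θ • w with hu'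
  set w' := Real.sin θ • u + Real.cos θ • w with hw'
  have h5 := Real.sin_sq_add_cos_sq θ
  have huu : u' ⬝ᵥ u' = Real.cos θ ^ 2 * (u ⬝ᵥ u) + Real.sin θ ^ 2 * (w ⬝ᵥ w) -
      2 * Real.cos θ * Real.sin θ * (u ⬝ᵥ w) := by
    simp [hu', sub_dotProduct, dotProduct_sub, dotProduct_comm w u]; ring
  have hww : w' ⬝ᵥ w' = Real.sin θ ^ 2 * (u ⬝ᵥ u) + Real.cos θ ^ 2 * (w ⬝ᵥ w) +
      2 * Real.cos θ * Real.sin θ * (u ⬝ᵥ w) := by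
    simp [hw', add_dotProduct, dotProduct_add, dotProduct_comm w u]; ring
  have huw : u' ⬝ᵥ w' = 0 := by
    rw [← h1]
    simp [hu', hw', sub_dotProduct, dotProduct_add, dotProduct_comm w u]; ring
  obtain ⟨O, hO, hOx⟩ := exists_orthogonal_mulVec_eq_single
    (Fin.cons u' (Fin.cons w' 0) : Fin (n + 2) → Fin (n + 2) → ℝ) (by
      intro i j hij
      refine Fin.cases ?_ (fun i => Fin.cases ?_ (fun i => ?_) i) i hij <;>
        refine Fin.cases ?_ (fun j => Fin.cases ?_ (fun j => ?_) j) j <;>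
        simp [huw, dotProduct_comm w' u'])
  have hα : Real.sqrt (u' ⬝ᵥ u') ^ 2 = u' ⬝ᵥ u' := Real.sq_sqrt (dotProduct_self_nonneg_of_real _)
  have hβ : Real.sqrt (w' ⬝ᵥ w') ^ 2 = w' ⬝ᵥ w' := Real.sq_sqrt (dotProduct_self_nonneg_of_real _)
  refine ⟨O, Real.sqrt (u' ⬝ᵥ u'), Real.sqrt (w' ⬝ᵥ w'), hO, ?_, ?_, ?_, ?_⟩
  · rw [hα, hβ, huu, hww]; linarith
  · rw [hα, hβ, huu, hww]; linear_combination (u ⬝ᵥ u + w ⬝ᵥ w) * h5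
  · have : (u' ⬝ᵥ u') * (w' ⬝ᵥ w') - (u' ⬝ᵥ w') ^ 2 = (u ⬝ᵥ u) * (w ⬝ᵥ w) - (u ⬝ᵥ w) ^ 2 := by
      rw [huw, ← h1, huu, hww]
      have h6 : Real.cos θ ^ 2 = 1 - Real.sin θ ^ 2 := by linarith
      linear_combination ((u ⬝ᵥ u) * (w ⬝ᵥ w) - (u ⬝ᵥ w) ^ 2) *
        (Real.sin θ ^ 2 + Real.cos θ ^ 2 + 1) * h5
    rw [hα, hβ, ← this, huw]; ring
  · intro k g
    rw [← complexGramDet_rotate g u w θ]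
    have e1 := hOx 0
    have e2 := hOx 1
    have e3 : (Fin.cons u' (Fin.cons w' 0) : Fin (n + 2) → Fin (n + 2) → ℝ) 1 = w' := rfl
    rw [e3] at e2
    rw [Fin.cons_zero] at e1
    rw [← e1, ← e2, complexGramDet, complexGramDet, mixedGramDet_mulVec O hO,
      mixedGramDet_mulVec O hO]

/-- Used to condition on the removed row: it suffices that the conditional laws agree for every
value of the first component. -/
lemma map_prod_congr_right {α β γ E : Type*} [MeasurableSpace α] [MeasurableSpace β]
    [MeasurableSpace γ] [MeasurableSpace E] {μ : Measure α} {ν : Measure β} {ρ : Measure γ}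
    [SFinite μ] [SFinite ν] [SFinite ρ] {f : α × β → E} {g : α × γ → E} (hf : Measurable f)
    (hg : Measurable g)
    (h : ∀ a, ν.map (fun b => f (a, b)) = ρ.map (fun c => g (a, c))) :
    (μ.prod ν).map f = (μ.prod ρ).map g := by
  ext s hs
  rw [Measure.map_apply hf hs, Measure.map_apply hg hs, Measure.prod_apply (hf hs),
    Measure.prod_apply (hg hs)]
  congr 1
  ext a
  have := congrArg (fun m => m s) (h a)
  rwa [Measure.map_apply (f := fun b => f (a, b)) (hf.comp measurable_prodMk_left) hs,
    Measure.map_apply (f := fun c => g (a, c)) (hg.comp measurable_prodMk_left) hs] at this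

/-- Removing from the Gaussian rows the first one, `y`, projects the remaining rows to the
orthogonal complement of `y`. -/
lemma exists_map_complexGramDet_cons {n : ℕ} (v : ℝ≥0) (y u w : Fin (n + 1) → ℝ) :
    ∃ u' w' : Fin n → ℝ,
      (y ⬝ᵥ y) * (u' ⬝ᵥ u') = (y ⬝ᵥ y) * (u ⬝ᵥ u) - (u ⬝ᵥ y) ^ 2 ∧
      (y ⬝ᵥ y) * (w' ⬝ᵥ w') = (y ⬝ᵥ y) * (w ⬝ᵥ w) - (w ⬝ᵥ y) ^ 2 ∧
      (y ⬝ᵥ y) * (u' ⬝ᵥ w') = (y ⬝ᵥ y) * (u ⬝ᵥ w) - (u ⬝ᵥ y) * (w ⬝ᵥ y) ∧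
      ∀ k : ℕ, (Measure.pi fun _ : Fin k => isoGaussian (Fin (n + 1)) v).map
          (fun g => complexGramDet (Fin.cons y g : Fin (k + 1) → Fin (n + 1) → ℝ) u w) =
        (Measure.pi fun _ : Fin k => isoGaussian (Fin n) v).map
          (fun g => (y ⬝ᵥ y) * complexGramDet g u' w') := by
  obtain ⟨O, hO, hOx⟩ := exists_orthogonal_mulVec_eq_single
    (Pi.single 0 y : Fin (n + 1) → Fin (n + 1) → ℝ) (by
      intro i j hij
      by_cases h : i = 0
      · have : j ≠ 0 := fun h' => hij (h.trans h'.symm)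
        simp [this]
      · simp [h])
  replace hOx := hOx 0
  rw [Pi.single_eq_same] at hOx
  have hN : Real.sqrt (y ⬝ᵥ y) ^ 2 = y ⬝ᵥ y := Real.sq_sqrt (dotProduct_self_nonneg_of_real _)
  -- O rotates y onto the first axis, so projecting away from y means dropping coordinate 0. The
  -- identities are multiplied by y·y so as to include y = 0.
  set r := Real.sqrt (y ⬝ᵥ y)
  have hdot : ∀ x y : Fin (n + 1) → ℝ, (O *ᵥ x) ⬝ᵥ (O *ᵥ y) = x ⬝ᵥ y := fun x y => by
    rw [dotProduct_mulVec, ← mulVec_transpose, mulVec_mulVec, hO, one_mulVec]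
  have h0 : ∀ a, r * (O *ᵥ a) 0 = a ⬝ᵥ y := fun a => by
    rw [← hdot, hOx]; simp [mul_comm]
  have htail : ∀ a b, (y ⬝ᵥ y) * (Fin.tail (O *ᵥ a) ⬝ᵥ Fin.tail (O *ᵥ b)) =
      (y ⬝ᵥ y) * (a ⬝ᵥ b) - (a ⬝ᵥ y) * (b ⬝ᵥ y) := fun a b => by
    have : a ⬝ᵥ b = (O *ᵥ a) 0 * (O *ᵥ b) 0 + Fin.tail (O *ᵥ a) ⬝ᵥ Fin.tail (O *ᵥ b) := by
      rw [← hdot a b]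
      simp [dotProduct, Fin.sum_univ_succ, Fin.tail]
    rw [← h0 a, ← h0 b, this, ← hN]; ring
  refine ⟨Fin.tail (O *ᵥ u), Fin.tail (O *ᵥ w), ?_, ?_, htail u w, fun k => ?_⟩
  · rw [htail]; ring
  · rw [htail]; ring
  have hmp := measurePreserving_pi (fun _ : Fin k => isoGaussian (Fin (n + 1)) v) _
    (fun _ => (measurePreserving_finTail_isoGaussian n v).comp
      (measurePreserving_mulVec_isoGaussian v O hO))
  rw [← hmp.map_eq, Measure.map_map (Continuous.measurable (by fun_prop)) hmp.measurable]
  congr 1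
  ext g
  have hc : (fun i => O *ᵥ (Fin.cons y g : Fin (k + 1) → Fin (n + 1) → ℝ) i) =
      Fin.cons (Pi.single 0 r) (fun i => O *ᵥ g i) := by
    ext i
    refine Fin.cases ?_ (fun i => ?_) i
    · simp [hOx]
    · simp
  rw [complexGramDet, ← mixedGramDet_mulVec O hO, ← mixedGramDet_mulVec O hO _ w w, hc,
    mixedGramDet_cons_single, mixedGramDet_cons_single, hN, ← mul_add]
  rfl


lemma chainFactor_mul_eq {c v x₁ x₂ α β U W N η : ℝ} (hN : N = c + v * (x₁ + x₂))
    (hU : N * U = α ^ 2 * (N - v * x₁)) (hW : N * W = β ^ 2 * (N - v * x₂))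
    (hη : (α ^ 2 + β ^ 2) * η = β ^ 2) :
    N * (U + W) = (α ^ 2 + β ^ 2) * (c + v * (η * x₁ + (1 - η) * x₂)) := by
  subst hN
  linear_combination hU + hW - v * (x₁ - x₂) * hη

/-- The core is (N - v x₁)(N - v x₂) - v x₁ · v x₂ = N c: the Gram determinant of the projected pair
depends on the old pair only through α²β², hence on η (1 - η) after normalisation. -/
lemma nextWeight_eq_mixing_div {c v x₁ x₂ α β U W Z N η : ℝ} (hN : N = c + v * (x₁ + x₂))
    (hU : N * U = α ^ 2 * (N - v * x₁)) (hW : N * W = β ^ 2 * (N - v * x₂))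
    (hZ : (N * Z) ^ 2 = α ^ 2 * β ^ 2 * (v * x₁) * (v * x₂))
    (hη : (α ^ 2 + β ^ 2) * η = β ^ 2)
    (h0 : N * (U + W) ≠ 0) :
    (U * W - Z ^ 2) / (U + W) ^ 2 =
      η * (1 - η) * c * (c + v * (x₁ + x₂)) / (c + v * (η * x₁ + (1 - η) * x₂)) ^ 2 := by
  have hf := chainFactor_mul_eq hN hU hW hη
  set f := c + v * (η * x₁ + (1 - η) * x₂)
  have hN0 : N ≠ 0 := left_ne_zero_of_mul h0
  have hUW : U + W ≠ 0 := right_ne_zero_of_mul h0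
  have hs : α ^ 2 + β ^ 2 ≠ 0 := left_ne_zero_of_mul (hf ▸ h0)
  have hf0 : f ≠ 0 := right_ne_zero_of_mul (hf ▸ h0)
  have h1 : N ^ 2 * (U * W - Z ^ 2) = α ^ 2 * β ^ 2 * N * c := by
    have : N ^ 2 * (U * W - Z ^ 2) = (N * U) * (N * W) - (N * Z) ^ 2 := by ring
    rw [this, hU, hW, hZ, hN]; ring
  have h2 : (α ^ 2 + β ^ 2) ^ 2 * (η * (1 - η)) = α ^ 2 * β ^ 2 := by
    have : (α ^ 2 + β ^ 2) * (1 - η) = α ^ 2 := by linarith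
    calc _ = ((α ^ 2 + β ^ 2) * η) * ((α ^ 2 + β ^ 2) * (1 - η)) := by ring
      _ = _ := by rw [hη, this]; ring
  have h3 : (U * W - Z ^ 2) / (U + W) ^ 2 =
      (N ^ 2 * (U * W - Z ^ 2)) / (N * (U + W)) ^ 2 := by
    field_simp
  rw [h3, h1, hf, ← h2, ← hN]
  field_simp

/-- Induction on the number of Gaussian rows, for all u, w at once: conditionally on the removed
row, the rest is the same problem one dimension lower with the projected pair. -/
theorem map_complexGramDet (v : ℝ≥0) (k n : ℕ) (hkn : k + 1 ≤ n) (u w : Fin n → ℝ) :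
    (Measure.pi fun _ : Fin k => isoGaussian (Fin n) v).map (fun g => complexGramDet g u w) =
      (Measure.pi fun j : Fin k => factorLaw (n - (j + 2)) v).map (fun x =>
        (u ⬝ᵥ u + w ⬝ᵥ w) * chainProd k v (pairWeight u w) (extendZero x)) := by
  induction k generalizing n with
  | zero =>
    simp [complexGramDet, mixedGramDet_zero, chainProd, Measure.map_const]
  | succ k ih =>
    obtain ⟨n, rfl⟩ : ∃ n', n = n' + 2 := ⟨n - 2, by omega⟩
    obtain ⟨O, α, β, hO, hαβ, hs, hq, hcan⟩ := exists_canonical_pair u w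
    have hη : (α ^ 2 + β ^ 2) * pairWeight u w = β ^ 2 := by
      by_cases h0 : α ^ 2 + β ^ 2 = 0
      · rw [h0, zero_mul]; nlinarith [sq_nonneg α, sq_nonneg β]
      · rw [pairWeight, ← hq, ← hs, mixing_div_sq (sq_nonneg β) hαβ h0, mul_div_cancel₀ _ h0]
    rw [← hs]
    set η := pairWeight u w
    have hrot := measurePreserving_pi (fun _ : Fin (k + 1) => isoGaussian (Fin (n + 2)) v) _
      (fun _ => measurePreserving_mulVec_isoGaussian v O hO)
    have e1 : (fun g : Fin (k + 1) → Fin (n + 2) → ℝ => complexGramDet g u w) =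
        (fun g => complexGramDet g (Pi.single 0 α) (Pi.single 1 β)) ∘
          (fun g i => O *ᵥ g i) := by
      ext g; exact hcan _ g
    rw [e1, ← Measure.map_map (Continuous.measurable (by fun_prop)) hrot.measurable, hrot.map_eq]
    -- the first Gaussian row in terms of its first two coordinates and the rest
    let ρ : Measure (ℝ × ℝ × (Fin n → ℝ)) :=
      (gaussianReal 0 1).prod ((gaussianReal 0 1).prod (isoGaussian (Fin n) v))
    -- The first two coordinates are standard normals scaled by √v, since the X variables are
    -- χ²_{1,1} and `mixedChiSq` supplies the factor v.
    let Y : ℝ × ℝ × (Fin n → ℝ) → Fin (n + 2) → ℝ := fun a =>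
      Fin.cons (Real.sqrt v * a.1) (Fin.cons (Real.sqrt v * a.2.1) a.2.2)
    have hY : MeasurePreserving Y ρ (isoGaussian (Fin (n + 2)) v) := by
      have hsq := measurePreserving_sqrt_mul_gaussianReal v
      have c1 := measurePreserving_finCons (fun _ : Fin (n + 1) => gaussianReal 0 v)
      have c2 := measurePreserving_finCons (fun _ : Fin (n + 2) => gaussianReal 0 v)
      exact c2.comp (hsq.prod (c1.comp (hsq.prod (MeasurePreserving.id _))))
    let x₀ : ℝ × ℝ × (Fin n → ℝ) → ℝ × ℝ × ℝ := fun a => (a.2.2 ⬝ᵥ a.2.2, a.1 ^ 2, a.2.1 ^ 2)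
    have hx₀ : MeasurePreserving x₀ ρ (factorLaw n v) := by
      have hg := measurePreserving_sq_gaussianReal 1
      have h1 := hg.prod (hg.prod (measurePreserving_dotProduct_self n v))
      have h2 := (MeasurePreserving.id (scaledChiSq 1 1)).prod
        (Measure.measurePreserving_swap (μ := scaledChiSq 1 1) (ν := scaledChiSq n v))
      have h3 := Measure.measurePreserving_swap (μ := scaledChiSq 1 1)
        (ν := (scaledChiSq n v).prod (scaledChiSq 1 1))
      have h4 := measurePreserving_prodAssoc (scaledChiSq n v) (scaledChiSq 1 1) (scaledChiSq 1 1)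
      have h5 := (MeasurePreserving.id (scaledChiSq n v)).prod
        (Measure.measurePreserving_swap (μ := scaledChiSq 1 1) (ν := scaledChiSq 1 1))
      exact h5.comp (h4.comp (h3.comp (h2.comp h1)))
    have hcons := (measurePreserving_finCons
      (fun _ : Fin (k + 1) => isoGaussian (Fin (n + 2)) v)).comp
        (hY.prod (MeasurePreserving.id (Measure.pi fun _ : Fin k => isoGaussian (Fin (n + 2)) v)))
    have hκ := measurePreserving_finCons (fun j : Fin (k + 1) => factorLaw (n + 2 - (j + 2)) v)
    have hκ0 : n + 2 - ((0 : Fin (k + 1)) + 2 : ℕ) = n := by simp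
    -- Both the dimension and the index drop by one, so the degrees of freedom agree with those of
    -- the induction hypothesis.
    have hκs : ∀ j : Fin k, n + 2 - ((j.succ : ℕ) + 2) = n + 1 - (j + 2) := fun j => by
      rw [Fin.val_succ]; omega
    simp only [hκ0, hκs] at hκ
    have hcons' := hκ.comp (hx₀.prod (MeasurePreserving.id
      (Measure.pi fun j : Fin k => factorLaw (n + 1 - (j + 2)) v)))
    have m1 : Measurable (fun g : Fin (k + 1) → Fin (n + 2) → ℝ =>
        complexGramDet g (Pi.single 0 α) (Pi.single 1 β)) := Continuous.measurable (by fun_prop)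
    have m2 : Measurable (fun x : Fin (k + 1) → ℝ × ℝ × ℝ =>
        (α ^ 2 + β ^ 2) * chainProd (k + 1) v η (extendZero x)) :=
      (measurable_chainProd (k + 1) v measurable_const measurable_extendZero).const_mul _
    rw [← hcons.map_eq, ← hcons'.map_eq, Measure.map_map m1 hcons.measurable,
      Measure.map_map m2 hcons'.measurable]
    refine map_prod_congr_right (m1.comp hcons.measurable) (m2.comp hcons'.measurable) fun a => ?_
    obtain ⟨u', w', hu, hw, huw, hmap⟩ := exists_map_complexGramDet_cons v (Y a)
      (Pi.single 0 α) (Pi.single 1 β)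
    refine (hmap k).trans ?_
    have m3 : Measurable (fun g : Fin k → Fin (n + 1) → ℝ => complexGramDet g u' w') :=
      Continuous.measurable (by fun_prop)
    have e2 : (fun g : Fin k → Fin (n + 1) → ℝ => (Y a ⬝ᵥ Y a) * complexGramDet g u' w') =
        (fun t => (Y a ⬝ᵥ Y a) * t) ∘ (fun g => complexGramDet g u' w') := rfl
    rw [e2, ← Measure.map_map (by fun_prop) m3, ih (n + 1) (by omega),
      Measure.map_map (by fun_prop)
        ((measurable_chainProd k v measurable_const measurable_extendZero).const_mul _)]
    congr 1
    ext x
    obtain ⟨a₀, a₁, a₂⟩ := a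
    have hv : Real.sqrt v ^ 2 = v := Real.sq_sqrt v.2
    have hN : Y (a₀, a₁, a₂) ⬝ᵥ Y (a₀, a₁, a₂) = a₂ ⬝ᵥ a₂ + v * (a₀ ^ 2 + a₁ ^ 2) := by
      simp only [Y, dotProduct, Fin.sum_univ_succ, Fin.cons_zero, Fin.cons_succ]
      linear_combination (a₀ ^ 2 + a₁ ^ 2) * hv
    have hY0 : Y (a₀, a₁, a₂) 0 = Real.sqrt v * a₀ := rfl
    have hY1 : Y (a₀, a₁, a₂) 1 = Real.sqrt v * a₁ := rfl
    simp only [single_dotProduct, hY0, hY1, Pi.single_eq_same] at hu hw huw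
    have h01 : (Pi.single 1 β : Fin (n + 2) → ℝ) 0 = 0 := by simp
    rw [h01] at huw
    set N := Y (a₀, a₁, a₂) ⬝ᵥ Y (a₀, a₁, a₂)
    have hU : N * (u' ⬝ᵥ u') = α ^ 2 * (N - v * a₀ ^ 2) := by
      rw [hu]; linear_combination -(α ^ 2 * a₀ ^ 2) * hv
    have hW : N * (w' ⬝ᵥ w') = β ^ 2 * (N - v * a₁ ^ 2) := by
      rw [hw]; linear_combination -(β ^ 2 * a₁ ^ 2) * hv
    have hZ : (N * (u' ⬝ᵥ w')) ^ 2 = α ^ 2 * β ^ 2 * (v * a₀ ^ 2) * (v * a₁ ^ 2) := by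
      rw [huw]; linear_combination (α ^ 2 * β ^ 2 * a₀ ^ 2 * a₁ ^ 2) * (Real.sqrt v ^ 2 + v) * hv
    have hf := chainFactor_mul_eq hN hU hW hη
    have hc : chainFactor v η (a₂ ⬝ᵥ a₂, a₀ ^ 2, a₁ ^ 2) =
        a₂ ⬝ᵥ a₂ + v * (η * a₀ ^ 2 + (1 - η) * a₁ ^ 2) := rfl
    rw [← hc] at hf
    simp only [Function.comp_apply, Prod.map_apply, id_eq, chainProd_succ, extendZero_cons_zero,
      extendZero_cons_succ, x₀]
    rw [← mul_assoc, ← mul_assoc, hf]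
    -- If the projected complex row or y vanishes, both sides are 0 and the new weight is
    -- irrelevant.
    by_cases h0 : N * (u' ⬝ᵥ u' + w' ⬝ᵥ w') = 0
    · rw [← hf, h0, zero_mul, zero_mul]
    · rw [pairWeight, nextWeight_eq_mixing_div hN hU hW hZ hη h0]
      rfl

/-! ### Absolute continuity of the weights -/

/-- A nonzero strict derivative makes f locally antilipschitz, and such maps pull sets of
one-dimensional Hausdorff measure zero back to such sets. -/
lemma volume_inter_preimage_eq_zero {f : ℝ → ℝ} {s N : Set ℝ}
    (hf : ∀ x ∈ s, ∃ f' : ℝ, HasStrictDerivAt f f' x ∧ f' ≠ 0) (hN : volume N = 0) :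
    volume (s ∩ f ⁻¹' N) = 0 := by
  refine measure_null_of_locally_null _ fun x hx => ?_
  obtain ⟨f', hf', h0⟩ := hf x hx.1
  have h1 := hf'.isLittleO.def (c := |f'| / 2) (by positivity)
  rw [nhds_prod_eq] at h1
  obtain ⟨u, hu, hu2⟩ := Filter.mem_prod_self_iff.mp h1
  have hanti : AntilipschitzWith (Real.toNNReal (2 / |f'|)) (fun y : u => f y) := by
    refine AntilipschitzWith.of_le_mul_dist fun y z => ?_
    have h2 := hu2 (Set.mk_mem_prod y.2 z.2)
    simp only [Set.mem_ofPred_eq, Real.norm_eq_abs, ContinuousLinearMap.toSpanSingleton_apply, smul_eq_mul] at h2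
    rw [Real.coe_toNNReal _ (by positivity), Subtype.dist_eq, Real.dist_eq, Real.dist_eq]
    have h3 : |(y.1 - z.1) * f'| ≤ |f y - f z| + |f y - f z - (y.1 - z.1) * f'| := by
      have := abs_sub (f y - f z) (f y - f z - (y.1 - z.1) * f')
      rwa [sub_sub_cancel] at this
    rw [abs_mul] at h3
    have h4 : 0 < |f'| := abs_pos.mpr h0
    rw [div_mul_eq_mul_div, le_div_iff₀ h4]
    linarith
  refine ⟨u ∩ f ⁻¹' N, ?_, ?_⟩
  · filter_upwards [self_mem_nhdsWithin, mem_nhdsWithin_of_mem_nhds hu] with y hy hy'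
    exact ⟨hy', hy.2⟩
  · have h2 : u ∩ f ⁻¹' N = Subtype.val '' ((fun y : u => f y) ⁻¹' N) := by
      ext y
      simp [and_comm]
    rw [← hausdorffMeasure_real] at hN ⊢
    rw [h2, isometry_subtype_coe.hausdorffMeasure_image (Or.inl zero_le_one)]
    have h3 := hanti.hausdorffMeasure_preimage_le zero_le_one N
    rw [hN, mul_zero] at h3
    exact le_antisymm h3 zero_le

lemma prod_eq_zero_of_ae_symm {α β : Type*} [MeasurableSpace α] [MeasurableSpace β]
    {μ : Measure α} {ν : Measure β} [SFinite μ] [SFinite ν] {s : Set (α × β)}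
    (hs : MeasurableSet s) (h : ∀ᵐ b ∂ν, μ ((fun a => (a, b)) ⁻¹' s) = 0) : μ.prod ν s = 0 := by
  rw [Measure.prod_apply_symm hs, lintegral_eq_zero_iff (measurable_measure_prodMk_right hs)]
  exact h

lemma ae_nonneg_scaledChiSq (n : ℕ) (v : ℝ≥0) : ∀ᵐ c ∂(scaledChiSq n v), 0 ≤ c := by
  rw [← (measurePreserving_dotProduct_self n v).map_eq,
    ae_map_iff (measurePreserving_dotProduct_self n v).aemeasurable measurableSet_Ici]
  exact Filter.Eventually.of_forall fun x => dotProduct_self_nonneg_of_real x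

lemma measurePreserving_sq_add_dotProduct (n : ℕ) (v : ℝ≥0) :
    MeasurePreserving (fun p : ℝ × (Fin n → ℝ) => p.1 ^ 2 + p.2 ⬝ᵥ p.2)
      ((gaussianReal 0 v).prod (isoGaussian (Fin n) v)) (scaledChiSq (n + 1) v) := by
  have h := (measurePreserving_dotProduct_self (n + 1) v).comp
    (measurePreserving_finCons (fun _ : Fin (n + 1) => gaussianReal 0 v))
  convert h using 1
  ext p
  simp [dotProduct, Fin.sum_univ_succ, pow_two]

/-- Fix all coordinates but one: a ↦ a² + const has nonzero derivative off a = 0. -/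
lemma scaledChiSq_absolutelyContinuous {n : ℕ} {v : ℝ≥0} (hn : n ≠ 0) (hv : v ≠ 0) :
    scaledChiSq n v ≪ volume := by
  obtain ⟨n, rfl⟩ := Nat.exists_eq_succ_of_ne_zero hn
  have h := measurePreserving_sq_add_dotProduct n v
  refine Measure.AbsolutelyContinuous.mk fun N hN hN0 => ?_
  rw [Nat.succ_eq_add_one, ← h.map_eq, Measure.map_apply h.measurable hN]
  refine prod_eq_zero_of_ae_symm (h.measurable hN) (Filter.Eventually.of_forall fun b => ?_)
  apply gaussianReal_absolutelyContinuous 0 hv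
  have h1 : volume ({0}ᶜ ∩ (fun a : ℝ => a ^ 2 + b ⬝ᵥ b) ⁻¹' N) = 0 := by
    refine volume_inter_preimage_eq_zero (fun x hx => ⟨2 * x, ?_, ?_⟩) hN0
    · simpa using (hasStrictDerivAt_pow 2 x).add_const (b ⬝ᵥ b)
    · exact mul_ne_zero two_ne_zero hx
  refine measure_mono_null (t := {0} ∪ ({0}ᶜ ∩ (fun a : ℝ => a ^ 2 + b ⬝ᵥ b) ⁻¹' N)) ?_
    (measure_union_null (by simp) h1)
  intro x hx
  by_cases h0 : x = 0
  · exact Or.inl h0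
  · exact Or.inr ⟨h0, hx⟩

lemma mixing_mul_one_sub {q : ℝ} (h0 : 0 ≤ q) (h1 : q ≤ 1 / 4) :
    mixing q * (1 - mixing q) = q := by
  have := Real.sq_sqrt (show 0 ≤ 1 - 4 * q by linarith)
  rw [mixing, abs_of_nonneg h0]
  linear_combination -this / 4

/-- `mixing` is not differentiable at 1/4, but its left inverse x ↦ x (1 - x) is smooth and maps
null sets to null sets, so only f needs a nonzero derivative. -/
lemma volume_mixing_comp_preimage_eq_zero {f : ℝ → ℝ} {s Z N : Set ℝ}
    (h01 : ∀ x ∈ s, 0 ≤ f x ∧ f x ≤ 1 / 4) (hZ : volume Z = 0)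
    (hf : ∀ x ∈ s, x ∉ Z → ∃ f' : ℝ, HasStrictDerivAt f f' x ∧ f' ≠ 0) (hN : volume N = 0) :
    volume (s ∩ (fun x => mixing (f x)) ⁻¹' N) = 0 := by
  have h1 : volume ((fun x : ℝ => x * (1 - x)) '' N) = 0 :=
    addHaar_image_eq_zero_of_differentiableOn_of_addHaar_eq_zero volume
      (by fun_prop) hN
  have h2 := volume_inter_preimage_eq_zero (s := s \ Z) (fun x hx => hf x hx.1 hx.2) h1
  refine measure_mono_null ?_ (measure_union_null hZ h2)
  intro x hx
  by_cases h : x ∈ Z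
  · exact Or.inl h
  · exact Or.inr ⟨⟨hx.1, h⟩, mixing (f x), hx.2, mixing_mul_one_sub (h01 x hx.1).1 (h01 x hx.1).2⟩

/-- The mixing weight of the first random factor, in terms of the first coordinate `x` and the
squared norm `r` of the remaining coordinates of the last row. -/
def baseWeight (M : ℝ) (p : ℝ × ℝ) : ℝ := mixing (M * p.2 / (M + p.1 ^ 2 + p.2) ^ 2)

@[fun_prop]
lemma measurable_baseWeight (M : ℝ) : Measurable (baseWeight M) := by
  unfold baseWeight
  fun_prop

lemma map_baseWeight_absolutelyContinuous {M : ℝ} (hM : 0 < M) {n : ℕ} {v : ℝ≥0} (hn : n ≠ 0)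
    (hv : v ≠ 0) :
    ((gaussianReal 0 v).prod (scaledChiSq n v)).map (baseWeight M) ≪ volume := by
  refine Measure.AbsolutelyContinuous.mk fun N hN hN0 => ?_
  rw [Measure.map_apply (measurable_baseWeight M) hN]
  rw [Measure.measure_prod_null (measurable_baseWeight M hN)]
  refine Filter.Eventually.of_forall fun x => ?_
  have h1 : volume (Set.Ici 0 ∩ (fun r => mixing (M * r / (M + x ^ 2 + r) ^ 2)) ⁻¹' N) = 0 := by
    -- The removed point is the only critical point of r ↦ M r / (M + x² + r)² on r ≥ 0.
    refine volume_mixing_comp_preimage_eq_zero (Z := {M + x ^ 2}) ?_ (by simp) ?_ hN0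
    · intro r (hr : 0 ≤ r)
      have hb : 0 < M + x ^ 2 + r := by positivity
      refine ⟨by positivity, ?_⟩
      rw [div_le_div_iff₀ (by positivity) (by norm_num)]
      nlinarith [sq_nonneg (M + x ^ 2 - r), mul_nonneg hr (sq_nonneg x)]
    · intro r (hr : 0 ≤ r) hrZ
      have hb : 0 < M + x ^ 2 + r := by positivity
      have d1 : HasStrictDerivAt (fun r => M * r) M r := by
        simpa using (hasStrictDerivAt_id r).const_mul M
      have d2 : HasStrictDerivAt (fun r => (M + x ^ 2 + r) ^ 2) (2 * (M + x ^ 2 + r)) r := by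
        simpa using ((hasStrictDerivAt_id r).const_add (M + x ^ 2)).fun_pow 2
      refine ⟨_, d1.div d2 (by positivity), ?_⟩
      refine div_ne_zero ?_ (by positivity)
      have : M * (M + x ^ 2 + r) ^ 2 - M * r * (2 * (M + x ^ 2 + r)) =
          M * (M + x ^ 2 + r) * (M + x ^ 2 - r) := by ring
      rw [this]
      refine mul_ne_zero (by positivity) (sub_ne_zero.mpr fun h => hrZ h.symm)
  have h2 := scaledChiSq_absolutelyContinuous hn hv h1
  have h3 : scaledChiSq n v (Set.Iio 0) = 0 := by
    have := ae_nonneg_scaledChiSq n v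
    rw [ae_iff] at this
    simpa [Set.Iio] using this
  refine measure_mono_null ?_ (measure_union_null h3 h2)
  intro r hr
  by_cases h : r < 0
  · exact Or.inl h
  · exact Or.inr ⟨not_lt.mp h, hr⟩

lemma ae_pos_scaledChiSq {n : ℕ} {v : ℝ≥0} (hn : n ≠ 0) (hv : v ≠ 0) :
    ∀ᵐ c ∂(scaledChiSq n v), 0 < c := by
  have h0 : ∀ᵐ c ∂(scaledChiSq n v), c ≠ 0 :=
    (scaledChiSq_absolutelyContinuous hn hv).ae_le (Measure.ae_ne volume 0)
  filter_upwards [ae_nonneg_scaledChiSq n v, h0] with c h1 h2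
  exact lt_of_le_of_ne h1 h2.symm

/-- The density comes from the χ² variable c with η, x₁, x₂ held fixed; that of η only serves to
exclude the endpoints 0 and 1, where the map in c is constant. -/
lemma map_nextWeight_absolutelyContinuous {μ : Measure ℝ} [SFinite μ] (hμ : μ ≪ volume)
    (hμ01 : ∀ᵐ η ∂μ, η ∈ Set.Icc (0 : ℝ) 1) {n : ℕ} {v : ℝ≥0} (hn : n ≠ 0) (hv : v ≠ 0) :
    (μ.prod (factorLaw n v)).map (fun p => nextWeight v p.1 p.2) ≪ volume := by
  refine Measure.AbsolutelyContinuous.mk fun N hN hN0 => ?_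
  have hm : Measurable (fun p : ℝ × ℝ × ℝ × ℝ => nextWeight v p.1 p.2) := by fun_prop
  rw [Measure.map_apply hm hN, Measure.measure_prod_null (hm hN)]
  filter_upwards [hμ01, hμ.ae_le (Measure.ae_ne volume 0), hμ.ae_le (Measure.ae_ne volume 1)]
    with η hη h0 h1
  have hη0 : 0 < η := lt_of_le_of_ne hη.1 h0.symm
  have hη1 : 0 < 1 - η := sub_pos.mpr (lt_of_le_of_ne hη.2 h1)
  refine prod_eq_zero_of_ae_symm (measurable_prodMk_left (hm hN)) ?_
  have hpos : ∀ᵐ x ∂(scaledChiSq 1 1).prod (scaledChiSq 1 1), 0 < x.1 ∧ 0 < x.2 := by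
    have h := ae_pos_scaledChiSq (n := 1) (v := 1) one_ne_zero one_ne_zero
    filter_upwards [Measure.quasiMeasurePreserving_fst.ae h,
      Measure.quasiMeasurePreserving_snd.ae h] with x a b
    exact ⟨a, b⟩
  filter_upwards [hpos] with x hx
  obtain ⟨x₁, x₂⟩ := x
  obtain ⟨hx₁, hx₂⟩ := hx
  simp only at hx₁ hx₂
  have hv0 : (0 : ℝ) < v := by positivity
  set t : ℝ := v * (η * x₁ + (1 - η) * x₂) with ht
  set S : ℝ := v * (x₁ + x₂) with hS
  have ht0 : 0 < t := by positivity
  have hS0 : 0 < S := by positivity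
  have hfun : (fun c : ℝ => nextWeight v η (c, x₁, x₂)) =
      fun c => mixing (η * (1 - η) * (c * (c + S)) / (c + t) ^ 2) := by
    ext c
    simp only [nextWeight, chainFactor, mixedChiSq, ← ht, ← hS]
    congr 2
    ring
  have h2 : volume (Set.Ici 0 ∩ (fun c : ℝ => nextWeight v η (c, x₁, x₂)) ⁻¹' N) = 0 := by
    rw [hfun]
    -- The removed point is the zero of c (2t - S) + S t, the derivative up to nonvanishing factors.
    -- If 2t = S there is no zero, and division by 0 merely removes the point 0.
    refine volume_mixing_comp_preimage_eq_zero (Z := {-(S * t) / (2 * t - S)}) ?_ (by simp) ?_ hN0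
    · intro c (hc : 0 ≤ c)
      refine ⟨by positivity, ?_⟩
      rw [div_le_div_iff₀ (by positivity) (by norm_num)]
      -- This square plus a nonnegative term shows that the argument of `mixing` is at most 1/4.
      have : (c + t) ^ 2 - 4 * (η * (1 - η) * (c * (c + S))) =
          ((1 - 2 * η) * c - v * (η * x₁ - (1 - η) * x₂)) ^ 2 +
            4 * (η * (1 - η)) * (v * x₁) * (v * x₂) := by
        rw [ht, hS]; ring
      have h3 : 0 ≤ 4 * (η * (1 - η)) * (v * x₁) * (v * x₂) := by positivity
      nlinarith [sq_nonneg ((1 - 2 * η) * c - v * (η * x₁ - (1 - η) * x₂))]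
    · intro c (hc : 0 ≤ c) hcZ
      have d1 : HasStrictDerivAt (fun c => η * (1 - η) * (c * (c + S)))
          (η * (1 - η) * (1 * (c + S) + c * 1)) c :=
        ((hasStrictDerivAt_id c).mul ((hasStrictDerivAt_id c).add_const S)).const_mul _
      have d2 : HasStrictDerivAt (fun c => (c + t) ^ 2) (2 * (c + t)) c := by
        simpa using ((hasStrictDerivAt_id c).add_const t).fun_pow 2
      refine ⟨_, d1.div d2 (by positivity), ?_⟩
      refine div_ne_zero ?_ (by positivity)
      have : η * (1 - η) * (1 * (c + S) + c * 1) * (c + t) ^ 2 -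
          η * (1 - η) * (c * (c + S)) * (2 * (c + t)) =
          η * (1 - η) * (c + t) * (c * (2 * t - S) + S * t) := by ring
      rw [this]
      refine mul_ne_zero (by positivity) fun h => hcZ ?_
      have h4 : 2 * t - S ≠ 0 := by
        intro h5
        rw [h5, mul_zero, zero_add] at h
        exact (mul_pos hS0 ht0).ne' h
      rw [Set.mem_singleton_iff, eq_div_iff h4]
      linarith
  have h3 := scaledChiSq_absolutelyContinuous hn hv h2
  have h4 : scaledChiSq n v (Set.Iio 0) = 0 := by
    have := ae_nonneg_scaledChiSq n v
    rw [ae_iff] at this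
    simpa [Set.Iio] using this
  refine measure_mono_null ?_ (measure_union_null h4 h3)
  intro c hc
  by_cases h : c < 0
  · exact Or.inl h
  · exact Or.inr ⟨not_lt.mp h, hc⟩

/-! ### Independence and realisation of the variables -/

/-- Overwriting coordinate i by 0 encodes "all other variables" without changing the index type. -/
lemma indepFun_eval_update {B α : Type*} [MeasurableSpace B] [MeasurableSpace α] [Zero α]
    (β : Measure B) [IsProbabilityMeasure β] {k : ℕ} (μ : Fin k → Measure α)
    [∀ i, IsProbabilityMeasure (μ i)] (i : Fin k) :
    IndepFun (fun ω : B × (Fin k → α) => ω.2 i) (fun ω => (ω.1, Function.update ω.2 i 0))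
      (β.prod (Measure.pi μ)) := by
  obtain ⟨k, rfl⟩ : ∃ k', k = k' + 1 := ⟨k - 1, by have := i.2; omega⟩
  let ρ := Measure.pi fun j => μ (i.succAbove j)
  have h1 := (MeasurePreserving.id β).prod
    (measurePreserving_piFinSuccAbove (α := fun _ => α) μ i)
  have h2 := (measurePreserving_prodAssoc β (μ i) ρ).symm
  have h3 := (Measure.measurePreserving_swap (μ := β) (ν := μ i)).prod (MeasurePreserving.id ρ)
  have h4 := measurePreserving_prodAssoc (μ i) β ρ
  have h := h4.comp (h3.comp (h2.comp h1))
  have hind : IndepFun (fun ω : B × (Fin (k + 1) → α) => ω.2 i)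
      (fun ω => (ω.1, i.removeNth ω.2)) (β.prod (Measure.pi μ)) := by
    have e1 := ((measurePreserving_fst (μ := μ i) (ν := β.prod ρ)).comp h)
    have e2 := ((measurePreserving_snd (μ := μ i) (ν := β.prod ρ)).comp h)
    refine (indepFun_iff_map_prod_eq_prod_map_map e1.aemeasurable e2.aemeasurable).2 ?_
    rw [e1.map_eq, e2.map_eq]
    exact h.map_eq
  have hm : Measurable (fun p : B × (Fin k → α) =>
      (p.1, (i.insertNth 0 p.2 : Fin (k + 1) → α))) := by
    refine measurable_fst.prodMk (measurable_pi_lambda _ fun j => ?_)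
    refine Fin.succAboveCases i ?_ (fun j => ?_) j
    · simp
    · simp only [Fin.insertNth_apply_succAbove]
      fun_prop
  have h5 := hind.comp measurable_id hm
  have e3 : (fun ω : B × (Fin (k + 1) → α) => (ω.1, Function.update ω.2 i 0)) =
      (fun p : B × (Fin k → α) => (p.1, (i.insertNth 0 p.2 : Fin (k + 1) → α))) ∘
        fun ω => (ω.1, i.removeNth ω.2) := by
    ext ω : 1
    simp
  rw [e3]
  exact h5

lemma iIndepFun_sumElim_factors {B : Type*} [MeasurableSpace B] (β : Measure B)
    [IsProbabilityMeasure β] {k : ℕ} {C₁ : B → ℝ} (hC₁ : Measurable C₁)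
    (μ ν₁ ν₂ : Fin k → Measure ℝ) [∀ i, IsProbabilityMeasure (μ i)]
    [∀ i, IsProbabilityMeasure (ν₁ i)] [∀ i, IsProbabilityMeasure (ν₂ i)] :
    iIndepFun (Sum.elim (fun _ : Unit => fun ω : B × (Fin k → ℝ × ℝ × ℝ) => C₁ ω.1)
      (Sum.elim (fun i ω => (ω.2 i).1) (Sum.elim (fun i ω => (ω.2 i).2.1)
        (fun i ω => (ω.2 i).2.2))))
      (β.prod (Measure.pi fun i => (μ i).prod ((ν₁ i).prod (ν₂ i)))) := by
  set κ : Fin k → Measure (ℝ × ℝ × ℝ) := fun i => (μ i).prod ((ν₁ i).prod (ν₂ i)) with hκ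
  set f := Sum.elim (fun _ : Unit => fun ω : B × (Fin k → ℝ × ℝ × ℝ) => C₁ ω.1)
      (Sum.elim (fun i ω => (ω.2 i).1) (Sum.elim (fun i ω => (ω.2 i).2.1)
        (fun i ω => (ω.2 i).2.2))) with hf
  have hfm : ∀ s, Measurable (f s) := by
    rintro (_ | i | i | i) <;> simp only [hf, Sum.elim_inl, Sum.elim_inr] <;> fun_prop
  have hev : ∀ i, MeasurePreserving (fun ω : B × (Fin k → ℝ × ℝ × ℝ) => ω.2 i)
      (β.prod (Measure.pi κ)) (κ i) := fun i =>
    (measurePreserving_eval κ i).comp measurePreserving_snd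
  rw [iIndepFun_iff_map_fun_eq_pi_map fun s => (hfm s).aemeasurable]
  symm
  apply Measure.pi_eq
  intro A hA
  rw [Measure.map_apply (measurable_pi_lambda _ hfm) (MeasurableSet.univ_pi hA)]
  have hset : (fun ω s => f s ω) ⁻¹' Set.univ.pi A = (C₁ ⁻¹' A (Sum.inl ())) ×ˢ
      Set.univ.pi fun i => A (Sum.inr (Sum.inl i)) ×ˢ
        (A (Sum.inr (Sum.inr (Sum.inl i))) ×ˢ A (Sum.inr (Sum.inr (Sum.inr i)))) := by
    ext ω
    simp only [Set.mem_preimage, Set.mem_univ_pi, Set.mem_prod, Sum.forall, hf, Sum.elim_inl,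
      Sum.elim_inr]
    constructor
    · rintro ⟨a, b, c, d⟩
      exact ⟨a (), fun i => ⟨b i, c i, d i⟩⟩
    · rintro ⟨a, b⟩
      exact ⟨fun _ => a, fun i => (b i).1, fun i => (b i).2.1, fun i => (b i).2.2⟩
  rw [hset, Measure.prod_prod, Measure.pi_pi]
  simp only [Fintype.prod_sum_type, hκ, Measure.prod_prod, Finset.prod_mul_distrib,
    Finset.univ_unique, Finset.prod_singleton]
  have g0 : (β.prod (Measure.pi κ)).map (f (Sum.inl ())) (A (Sum.inl ())) =
      β (C₁ ⁻¹' A (Sum.inl ())) := by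
    have : MeasurePreserving (f (Sum.inl ())) (β.prod (Measure.pi κ)) (β.map C₁) :=
      (hC₁.measurePreserving β).comp measurePreserving_fst
    rw [this.map_eq, Measure.map_apply hC₁ (hA _)]
  have g1 : ∀ i, (β.prod (Measure.pi κ)).map (f (Sum.inr (Sum.inl i))) = μ i := fun i =>
    (measurePreserving_fst.comp (hev i)).map_eq
  have g2 : ∀ i, (β.prod (Measure.pi κ)).map (f (Sum.inr (Sum.inr (Sum.inl i)))) = ν₁ i :=
    fun i => (measurePreserving_fst.comp (measurePreserving_snd.comp (hev i))).map_eq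
  have g3 : ∀ i, (β.prod (Measure.pi κ)).map (f (Sum.inr (Sum.inr (Sum.inr i)))) = ν₂ i :=
    fun i => (measurePreserving_snd.comp (measurePreserving_snd.comp (hev i))).map_eq
  rw [hκ] at g0 g1 g2 g3
  simp only [g1, g2, g3]
  congr 1
  exact g0.symm

/-- The indices of the factors, counted from zero. -/
def factorIndexEquiv (k : ℕ) : FactorIndex (k + 1) ≃ Fin k where
  toFun i := ⟨i - 2, by have := Finset.mem_Icc.mp i.2; omega⟩
  invFun j := ⟨j + 2, Finset.mem_Icc.mpr ⟨by omega, by omega⟩⟩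
  left_inv i := Subtype.ext (by have := Finset.mem_Icc.mp i.2; simp only; omega)
  right_inv j := rfl

lemma factorIndexEquiv_add_two {k : ℕ} (i : FactorIndex (k + 1)) :
    (factorIndexEquiv k i : ℕ) + 2 = i := by
  have := Finset.mem_Icc.mp i.2
  change (i : ℕ) - 2 + 2 = i
  omega

lemma factorIndexEquiv_lt {k : ℕ} {i j : FactorIndex (k + 1)} (h : j < i) :
    factorIndexEquiv k j < factorIndexEquiv k i := by
  have h1 := factorIndexEquiv_add_two i
  have h2 := factorIndexEquiv_add_two j
  have h3 : (j : ℕ) < i := h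
  exact Fin.lt_def.mpr (by omega)

/-- The law of the variables on which the factors are realised. -/
abbrev factorMeasure {B : Type*} [MeasurableSpace B] (β : Measure B) (k n : ℕ) (v : ℝ≥0) :
    Measure (B × (Fin k → ℝ × ℝ × ℝ)) :=
  β.prod (Measure.pi fun j : Fin k => factorLaw (n - (j + 2)) v)

lemma indepFun_eval_of_forall_lt {B E : Type*} [MeasurableSpace B] [MeasurableSpace E]
    (β : Measure B) [IsProbabilityMeasure β] {k n : ℕ} {v : ℝ≥0} (i : Fin k)
    {f : B × (Fin k → ℝ × ℝ × ℝ) → E} (hf : Measurable f)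
    (hdep : ∀ b x x', (∀ j < i, x j = x' j) → f (b, x) = f (b, x')) :
    IndepFun (fun ω => ω.2 i) f (factorMeasure β k n v) := by
  have h := (indepFun_eval_update β (fun j : Fin k => factorLaw (n - (j + 2)) v) i).comp
    measurable_id hf
  have e : f = f ∘ fun ω => (ω.1, Function.update ω.2 i 0) := by
    ext ω : 1
    exact hdep ω.1 ω.2 _ fun j hj => by simp [Function.update_of_ne hj.ne]
  rw [e]
  exact h

/-- On the product space all independence claims reduce to one structural fact, that η i reads only
the base variable and the triples before i. -/
theorem EqInDistChiSqProduct.of_factorMeasure {Ω : Type*} [MeasurableSpace Ω] {P : Measure Ω}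
    {D : Ω → ℂ} {B : Type} [MeasurableSpace B] (β : Measure B) [IsProbabilityMeasure β]
    {k n : ℕ} {v : ℝ≥0} {C₁ : B → ℝ} (hC₁ : MeasurePreserving C₁ β (scaledChiSq n v))
    (η : Fin k → B × (Fin k → ℝ × ℝ × ℝ) → ℝ) (hη : ∀ i, Measurable (η i))
    (hdep : ∀ i b x x', (∀ j < i, x j = x' j) → η i (b, x) = η i (b, x'))
    (h01 : ∀ i ω, η i ω ∈ Set.Icc (0 : ℝ) 1)
    (hpdf : ∀ i, (factorMeasure β k n v).map (η i) ≪ volume)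
    (hD : AEMeasurable D P)
    (hlaw : P.map D = (factorMeasure β k n v).map (fun ω =>
      (((C₁ ω.1 + ((k + 1 : ℕ) : ℝ) * (n : ℝ)) *
        ∏ i : Fin k, chainFactor v (η i ω) (ω.2 i) : ℝ) : ℂ))) :
    EqInDistChiSqProduct (k + 1) n v P D := by
  let e := factorIndexEquiv k
  have hC₁m := hC₁.measurable
  have hev : ∀ i, MeasurePreserving (fun ω : B × (Fin k → ℝ × ℝ × ℝ) => ω.2 i)
      (factorMeasure β k n v) (factorLaw (n - (i + 2)) v) := fun i =>
    (measurePreserving_eval (fun j : Fin k => factorLaw (n - (j + 2)) v) i).comp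
      measurePreserving_snd
  refine ⟨B × (Fin k → ℝ × ℝ × ℝ), inferInstance, factorMeasure β k n v, fun ω => C₁ ω.1,
    fun i ω => (ω.2 (e i)).1, fun i ω => (ω.2 (e i)).2.1, fun i ω => (ω.2 (e i)).2.2,
    fun i => η (e i), inferInstance, (hC₁.comp measurePreserving_fst).hasLaw, ?_, ?_, ?_, ?_, ?_,
    fun i ω => h01 _ ω, ?_, ?_⟩
  · intro i
    have h := (measurePreserving_fst.comp (hev (e i))).hasLaw
    rwa [factorIndexEquiv_add_two i] at h
  · exact fun i => (measurePreserving_fst.comp (measurePreserving_snd.comp (hev (e i)))).hasLaw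
  · exact fun i => (measurePreserving_snd.comp (measurePreserving_snd.comp (hev (e i)))).hasLaw
  · have h := iIndepFun_sumElim_factors β hC₁m (fun j : Fin k => scaledChiSq (n - (j + 2)) v)
      (fun _ => scaledChiSq 1 1) (fun _ => scaledChiSq 1 1)
    have h2 := h.precomp (g := Sum.map id (Sum.map e (Sum.map e e)))
      (Function.injective_id.sumMap (e.injective.sumMap (e.injective.sumMap e.injective)))
    convert h2 using 1
    ext s ω
    rcases s with _ | i | i | i <;> rfl
  · intro i
    exact Real.hasPDF_iff.mpr ⟨(hη _).aemeasurable, hpdf _⟩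
  · intro i
    refine indepFun_eval_of_forall_lt β (e i) ?_ ?_
    · have := fun j => hη j
      refine Measurable.prodMk (by fun_prop) (Measurable.prodMk (by fun_prop) ?_)
      exact measurable_pi_lambda _ fun j => hη _
    · intro b x x' hx
      refine Prod.ext rfl (Prod.ext ?_ ?_)
      · ext1 j
        simp only [hx _ (factorIndexEquiv_lt j.2), e]
      · ext1 j
        refine hdep _ b x x' fun l hl => hx l (lt_of_lt_of_le hl ?_)
        rcases eq_or_lt_of_le j.2 with h | h
        · rw [h]
        · exact (factorIndexEquiv_lt h).le
  · refine ⟨hD, ?_, ?_⟩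
    · have h1 : Measurable (fun ω : B × (Fin k → ℝ × ℝ × ℝ) => (C₁ ω.1 + ((k + 1 : ℕ) : ℝ) * n) *
          ∏ i : FactorIndex (k + 1), ((ω.2 (e i)).1 +
            mixedChiSq v (η (e i) ω) (ω.2 (e i)).2.1 (ω.2 (e i)).2.2)) := by
        have h2 := fun j => hη j
        refine Measurable.mul (by fun_prop) (Finset.measurable_prod _ fun i _ => ?_)
        exact measurable_chainFactor v (hη (e i)) (by fun_prop)
      exact (Complex.measurable_ofReal.comp h1).aemeasurable
    · rw [hlaw]
      congr 1
      ext ω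
      rw [← e.prod_comp]
      rfl

/-! ### Assembly -/

lemma weightSeq_congr (v : ℝ≥0) (η : ℝ) {x x' : ℕ → ℝ × ℝ × ℝ} {j : ℕ}
    (h : ∀ i < j, x i = x' i) : weightSeq v η x j = weightSeq v η x' j := by
  induction j with
  | zero => rfl
  | succ j ih =>
    rw [weightSeq, weightSeq, ih fun i hi => h i (by omega), h j (by omega)]

lemma weightSeq_extendZero_congr (v : ℝ≥0) (η : ℝ) {k : ℕ} {x x' : Fin k → ℝ × ℝ × ℝ} {j : Fin k}
    (h : ∀ i < j, x i = x' i) :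
    weightSeq v η (extendZero x) j = weightSeq v η (extendZero x') j := by
  refine weightSeq_congr v η fun i hi => ?_
  have hik : i < k := hi.trans j.2
  simp only [extendZero, hik, dite_true]
  exact h ⟨i, hik⟩ hi

lemma weightSeq_mem_Icc (v : ℝ≥0) {η : ℝ} (hη : η ∈ Set.Icc (0 : ℝ) 1) (x : ℕ → ℝ × ℝ × ℝ)
    (j : ℕ) : weightSeq v η x j ∈ Set.Icc (0 : ℝ) 1 := by
  cases j with
  | zero => exact hη
  | succ j => exact mixing_mem_Icc _

lemma chainProd_extendZero (k : ℕ) (v : ℝ≥0) (η : ℝ) (x : Fin k → ℝ × ℝ × ℝ) :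
    chainProd k v η (extendZero x) =
      ∏ i : Fin k, chainFactor v (weightSeq v η (extendZero x) i) (x i) := by
  rw [chainProd, Finset.prod_range]
  simp [extendZero]

lemma map_weightSeq_absolutelyContinuous {B : Type*} [MeasurableSpace B] (β : Measure B)
    [IsProbabilityMeasure β] {k n : ℕ} (hkn : k + 1 ≤ n) {v : ℝ≥0} (hv : v ≠ 0) {η₀ : B → ℝ}
    (hη₀ : Measurable η₀) (hac : β.map η₀ ≪ volume) (h01 : ∀ b, η₀ b ∈ Set.Icc (0 : ℝ) 1)
    (j : ℕ) (hj : j < k) :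
    (factorMeasure β k n v).map (fun ω => weightSeq v (η₀ ω.1) (extendZero ω.2) j) ≪ volume := by
  have hm : ∀ j, Measurable (fun ω : B × (Fin k → ℝ × ℝ × ℝ) =>
      weightSeq v (η₀ ω.1) (extendZero ω.2) j) := fun j =>
    measurable_weightSeq v (hη₀.comp measurable_fst) (measurable_extendZero.comp measurable_snd) j
  induction j with
  | zero =>
    have : MeasurePreserving (fun ω : B × (Fin k → ℝ × ℝ × ℝ) => η₀ ω.1)
        (factorMeasure β k n v) (β.map η₀) :=
      (hη₀.measurePreserving β).comp measurePreserving_fst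
    simp only [weightSeq]
    rwa [this.map_eq]
  | succ j ih =>
    have hjk : j < k := by omega
    have hev : MeasurePreserving (fun ω : B × (Fin k → ℝ × ℝ × ℝ) => ω.2 ⟨j, hjk⟩)
        (factorMeasure β k n v) (factorLaw (n - (j + 2)) v) :=
      (measurePreserving_eval (fun j : Fin k => factorLaw (n - (j + 2)) v) ⟨j, hjk⟩).comp
        measurePreserving_snd
    have hind := indepFun_eval_of_forall_lt β (n := n) (v := v) ⟨j, hjk⟩ (hm j)
      fun b x x' h => weightSeq_extendZero_congr v (η₀ b) (j := ⟨j, hjk⟩) h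
    have hmap := (indepFun_iff_map_prod_eq_prod_map_map (hm j).aemeasurable hev.aemeasurable).1
      hind.symm
    rw [hev.map_eq] at hmap
    have e : (fun ω : B × (Fin k → ℝ × ℝ × ℝ) =>
        weightSeq v (η₀ ω.1) (extendZero ω.2) (j + 1)) =
        (fun p : ℝ × ℝ × ℝ × ℝ => nextWeight v p.1 p.2) ∘
          fun ω => (weightSeq v (η₀ ω.1) (extendZero ω.2) j, ω.2 ⟨j, hjk⟩) := by
      ext ω
      simp [weightSeq, extendZero, hjk]
    rw [e, ← Measure.map_map (by fun_prop) ((hm j).prodMk hev.measurable), hmap]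
    -- Here j + 2 ≤ k < n, so the χ² variable has positive degrees of freedom. Only the last factor
    -- can have none, and no weight is computed from it.
    refine map_nextWeight_absolutelyContinuous (ih hjk) ?_ (by omega) hv
    refine (ae_map_iff (p := fun η => η ∈ Set.Icc (0 : ℝ) 1) (hm j).aemeasurable
      measurableSet_Icc).2 ?_
    exact Filter.Eventually.of_forall fun ω => weightSeq_mem_Icc v (h01 ω.1) _ j

/-- Condition on the last row: its first coordinate x and the squared norm r of the rest determine
the initial weight, because M (x² + r) - (√M x)² = M r. -/
lemma map_complexGramDet_snoc (v : ℝ≥0) {k n : ℕ} (hkn : k ≤ n) {M : ℝ} (hM : 0 ≤ M) :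
    (Measure.pi fun _ : Fin (k + 1) => isoGaussian (Fin (n + 1)) v).map (fun X =>
        complexGramDet (fun i => X i.castSucc) (Pi.single 0 (Real.sqrt M)) (X (Fin.last k))) =
      (factorMeasure ((gaussianReal 0 v).prod (scaledChiSq n v)) k (n + 1) v).map (fun ω =>
        (ω.1.1 ^ 2 + ω.1.2 + M) * chainProd k v (baseWeight M ω.1) (extendZero ω.2)) := by
  have c1 := measurePreserving_finCons (fun _ : Fin (n + 1) => gaussianReal 0 v)
  have c2 := (measurePreserving_finSnoc (fun _ : Fin (k + 1) => isoGaussian (Fin (n + 1)) v)).comp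
    (c1.prod (MeasurePreserving.id (Measure.pi fun _ : Fin k => isoGaussian (Fin (n + 1)) v)))
  have c3 := ((MeasurePreserving.id (gaussianReal 0 v)).prod
    (measurePreserving_dotProduct_self n v)).prod (MeasurePreserving.id
      (Measure.pi fun j : Fin k => factorLaw (n + 1 - (j + 2)) v))
  have m1 : Measurable (fun X : Fin (k + 1) → Fin (n + 1) → ℝ =>
      complexGramDet (fun i => X i.castSucc) (Pi.single 0 (Real.sqrt M)) (X (Fin.last k))) :=
    Continuous.measurable (by fun_prop)
  have m2 : Measurable (fun ω : (ℝ × ℝ) × (Fin k → ℝ × ℝ × ℝ) =>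
      (ω.1.1 ^ 2 + ω.1.2 + M) * chainProd k v (baseWeight M ω.1) (extendZero ω.2)) :=
    Measurable.mul (by fun_prop) (measurable_chainProd k v (by fun_prop) (by fun_prop))
  rw [← c2.map_eq, factorMeasure, ← c3.map_eq, Measure.map_map m1 c2.measurable,
    Measure.map_map m2 c3.measurable]
  refine map_prod_congr_right (m1.comp c2.measurable) (m2.comp c3.measurable) fun a => ?_
  obtain ⟨x, y⟩ := a
  have h := map_complexGramDet v k (n + 1) (by omega) (Pi.single 0 (Real.sqrt M))
    (Fin.cons x y : Fin (n + 1) → ℝ)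
  have hs := Real.mul_self_sqrt hM
  have hyy : (Fin.cons x y : Fin (n + 1) → ℝ) ⬝ᵥ (Fin.cons x y : Fin (n + 1) → ℝ) =
      x ^ 2 + y ⬝ᵥ y := by
    simp [dotProduct, Fin.sum_univ_succ, pow_two]
  have hw : pairWeight (Pi.single 0 (Real.sqrt M)) (Fin.cons x y : Fin (n + 1) → ℝ) =
      baseWeight M (x, y ⬝ᵥ y) := by
    simp only [pairWeight, baseWeight, hyy, single_dotProduct, Pi.single_eq_same, Fin.cons_zero, hs]
    congr 1
    congr 1
    · linear_combination -(x ^ 2) * hs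
    · ring
  rw [hw, hyy, single_dotProduct, Pi.single_eq_same, hs] at h
  convert h using 1
  · congr 1
    ext g
    simp
  · congr 1
    ext z
    simp only [Function.comp_apply, Prod.map_apply, id_eq]
    ring

theorem eqInDistChiSqProduct_of_hasLaw {Ω : Type*} [MeasurableSpace Ω] {P : Measure Ω}
    {m n : ℕ} (hm : 1 ≤ m) (hmn : m ≤ n) {v : ℝ≥0} {X : Ω → Matrix (Fin m) (Fin n) ℝ}
    (hX : HasLaw (fun ω i j => X ω i j) (Measure.pi fun _ : Fin m => isoGaussian (Fin n) v) P) :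
    EqInDistChiSqProduct m n v P
      (fun ω => (linearizedPhaseMatrix (X ω) * (linearizedPhaseMatrix (X ω))ᴴ).det) := by
  obtain ⟨k, rfl⟩ : ∃ k, m = k + 1 := ⟨m - 1, by omega⟩
  obtain ⟨n, rfl⟩ : ∃ n', n = n' + 1 := ⟨n - 1, by omega⟩
  obtain ⟨U, O, hU, hO, hdet⟩ := exists_orthogonal_det_linearizedPhaseMatrix k n
  set M : ℝ := (k + 1) * (n + 1) with hMdef
  have hM : 0 < M := by positivity
  have hrot := measurePreserving_mul_mul_transpose v U O hU hO
  set F : (Fin (k + 1) → Fin (n + 1) → ℝ) → ℝ := fun X =>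
    complexGramDet (fun i => X i.castSucc) (Pi.single 0 (Real.sqrt M)) (X (Fin.last k)) with hF
  have hFm : Measurable F := Continuous.measurable (by fun_prop)
  set D := fun ω => (linearizedPhaseMatrix (X ω) * (linearizedPhaseMatrix (X ω))ᴴ).det with hD
  have hDF : D = ((fun t : ℝ => (t : ℂ)) ∘ F ∘ fun (X : Fin (k + 1) → Fin (n + 1) → ℝ) i j =>
      (U * Matrix.of X * Oᵀ) i j) ∘ (fun ω i j => X ω i j) := by
    ext ω
    exact hdet (X ω)
  have hFrot := hFm.comp hrot.measurable
  have hDm : AEMeasurable D P := by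
    rw [hDF]
    exact (Complex.measurable_ofReal.comp hFrot).comp_aemeasurable hX.aemeasurable
  set β₀ := (gaussianReal 0 v).prod (scaledChiSq n v) with hβ₀
  set G : (ℝ × ℝ) × (Fin k → ℝ × ℝ × ℝ) → ℝ := fun ω =>
    (ω.1.1 ^ 2 + ω.1.2 + M) * chainProd k v (baseWeight M ω.1) (extendZero ω.2) with hG
  have hGm : Measurable G :=
    Measurable.mul (by fun_prop) (measurable_chainProd k v (by fun_prop) (by fun_prop))
  have hlaw : P.map D = (factorMeasure β₀ k (n + 1) v).map (fun ω => (G ω : ℂ)) := by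
    rw [hDF, ← AEMeasurable.map_map_of_aemeasurable
      (Complex.measurable_ofReal.comp hFrot).aemeasurable hX.aemeasurable, hX.map_eq,
      ← Measure.map_map Complex.measurable_ofReal hFrot,
      ← Measure.map_map hFm hrot.measurable, hrot.map_eq,
      map_complexGramDet_snoc v (by omega) hM.le, Measure.map_map Complex.measurable_ofReal hGm]
    rfl
  have hC₁ : MeasurePreserving (fun b : ℝ × ℝ => b.1 ^ 2 + b.2) β₀ (scaledChiSq (n + 1) v) := by
    have h1 := (MeasurePreserving.id (gaussianReal 0 v)).prod
      (measurePreserving_dotProduct_self n v)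
    refine ⟨by fun_prop, ?_⟩
    rw [hβ₀, ← h1.map_eq, Measure.map_map (by fun_prop) h1.measurable]
    exact (measurePreserving_sq_add_dotProduct n v).map_eq
  have hbase : ∀ b, baseWeight M b ∈ Set.Icc (0 : ℝ) 1 := fun b => mixing_mem_Icc _
  rcases eq_or_ne v 0 with rfl | hv
  · -- the weights do not affect the product, so any weights with a density will do
    set U01 : Measure ℝ := volume.restrict (Set.Icc (0 : ℝ) 1) with hU01
    have : IsProbabilityMeasure U01 := ⟨by simp [hU01]⟩
    -- Clamping puts the uniform weight in [0, 1] everywhere, not just almost everywhere.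
    have hclamp : Measurable (fun u : ℝ => max 0 (min 1 u)) := by fun_prop
    refine EqInDistChiSqProduct.of_factorMeasure (β₀.prod U01) (hC₁.comp measurePreserving_fst)
      (fun _ ω => max 0 (min 1 ω.1.2)) (fun _ => by fun_prop) (fun _ _ _ _ _ => rfl)
      (fun _ ω => ⟨le_max_left _ _, max_le zero_le_one (min_le_left _ _)⟩) (fun _ => ?_) hDm ?_
    · have h1 : MeasurePreserving (fun ω : ((ℝ × ℝ) × ℝ) × (Fin k → ℝ × ℝ × ℝ) => ω.1.2)
          (factorMeasure (β₀.prod U01) k (n + 1) 0) U01 :=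
        measurePreserving_snd.comp measurePreserving_fst
      have h2 : U01.map (fun u : ℝ => max 0 (min 1 u)) = U01 := by
        have : (fun u : ℝ => max 0 (min 1 u)) =ᵐ[U01] id := by
          filter_upwards [ae_restrict_mem measurableSet_Icc] with u hu
          simp [hu.1, hu.2]
        rw [Measure.map_congr this, Measure.map_id]
      have h3 : (fun ω : ((ℝ × ℝ) × ℝ) × (Fin k → ℝ × ℝ × ℝ) => max 0 (min 1 ω.1.2)) =
          (fun u : ℝ => max 0 (min 1 u)) ∘ fun ω => ω.1.2 := rfl
      rw [h3, ← Measure.map_map hclamp h1.measurable, h1.map_eq, h2]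
      exact Measure.restrict_le_self.absolutelyContinuous
    · have h1 : MeasurePreserving (fun ω : ((ℝ × ℝ) × ℝ) × (Fin k → ℝ × ℝ × ℝ) => (ω.1.1, ω.2))
          (factorMeasure (β₀.prod U01) k (n + 1) 0) (factorMeasure β₀ k (n + 1) 0) :=
        measurePreserving_fst.prod (MeasurePreserving.id _)
      have hGc : Measurable fun ω => (G ω : ℂ) := Complex.measurable_ofReal.comp hGm
      rw [hlaw, ← h1.map_eq, Measure.map_map hGc h1.measurable]
      congr 1
      ext ω
      simp [hG, chainProd_extendZero, chainFactor, mixedChiSq, hMdef]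
  · refine EqInDistChiSqProduct.of_factorMeasure β₀ hC₁
      (fun i ω => weightSeq v (baseWeight M ω.1) (extendZero ω.2) i) (fun i =>
        measurable_weightSeq v (by fun_prop) (by fun_prop) i)
      (fun i b x x' h => weightSeq_extendZero_congr v _ h)
      (fun i ω => weightSeq_mem_Icc v (hbase _) _ _) (fun i => ?_) hDm ?_
    · have hn : n ≠ 0 := by have := i.2; omega
      exact map_weightSeq_absolutelyContinuous β₀ (by omega) hv (measurable_baseWeight M)
        (map_baseWeight_absolutelyContinuous hM hn hv) hbase i i.2
    · rw [hlaw]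
      congr 1
      ext ω
      simp [hG, chainProd_extendZero, hMdef]

theorem mainTheorem5 {Ω : Type*} [MeasurableSpace Ω] (P : Measure Ω)
    (MR MT : ℕ) (hMR : 1 ≤ MR) (hMT : 1 ≤ MT) (v : ℝ≥0)
    (Φ : Ω → Matrix (Fin MR) (Fin MT) ℝ)
    (hΦ : HasLaw (fun ω => WithLp.toLp 2 (Matrix.vec (Φ ω)))
      (multivariateGaussian (0 : EuclideanSpace ℝ (Fin MT × Fin MR))
        ((v : ℝ) • (1 : Matrix (Fin MT × Fin MR) (Fin MT × Fin MR) ℝ))) P) :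
    (MR ≤ MT → EqInDistChiSqProduct MR MT v P
      (fun ω => (linearizedPhaseMatrix (Φ ω) * (linearizedPhaseMatrix (Φ ω))ᴴ).det)) ∧
    (MT < MR → EqInDistChiSqProduct MT MR v P
      (fun ω => ((linearizedPhaseMatrix (Φ ω))ᴴ * linearizedPhaseMatrix (Φ ω)).det)) := by
  have hrows := hasLaw_rows_of_vec hΦ
  refine ⟨fun h => eqInDistChiSqProduct_of_hasLaw hMR h hrows, fun h => ?_⟩
  have hswap := measurePreserving_pi_swap (α := Fin MR) (β := Fin MT) (gaussianReal 0 v)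
  have hcols : HasLaw (fun ω i j => (Φ ω)ᵀ i j)
      (Measure.pi fun _ : Fin MT => isoGaussian (Fin MR) v) P := hswap.hasLaw.comp hrows
  have key := eqInDistChiSqProduct_of_hasLaw (X := fun ω => (Φ ω)ᵀ) hMT h.le hcols
  convert key using 2 with ω
  -- With A the matrix of Φ, the transpose of AᴴA is Aᵀ(Aᵀ)ᴴ, and Aᵀ is the matrix of Φᵀ.
  rw [← det_transpose, transpose_mul]
  congr 1

end
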